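/- Let $p$ be a prime, $m \ge 1$, $q = p^m$, and let $\mathbb{F}_q$ be the field with $q$ elements. For $a, x \in \mathbb{F}_q$ put $\psi_a(x) = \exp(2\pi i\, \mathrm{Tr}(ax)/p)$, where $\mathrm{Tr}(x) = \sum_{i=0}^{m-1} x^{p^i}$ is the trace from $\mathbb{F}_q$ to $\mathbb{F}_p$. For every $C_0 > 0$ there is a constant $C > 0$, depending only on $C_0$ (and not on $p$, $m$, $g$ or $K$), such that the following holds. Let $g \in \mathbb{F}_q^*$ have multiplicative order $t$ and suppose that $$\gcd(t, p^\nu - 1) \le C_0\, p^{\nu/2}$$ for all $\nu$ with $1 \le \nu < m$ and $\nu \mid m$. Then, for all integers $0 \le K \le t$, $$\sum_{a \in \mathbb{F}_q} \Big| \sum_{1 \le j \le K} \psi_a(g^j) \Big|^4 \le C \big( q K^{3 - 1/33} + q^{1 - 1/33} K^{3 + 1/33} \big),$$ $$\max_{a \in \mathbb{F}_q^*} \Big| \sum_{1 \le j \le K} \psi_a(g^j) \Big| \le C \big( q^{1/4} K^{65/132} + q^{8/33} K^{67/132} \big),$$ $$\max_{a \in \mathbb{F}_q^*} \Big| \sum_{1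 \le j \le K} \psi_a(g^j) \Big| \le C \big( q^{1/8} K^{49/66} + q^{31/264} K^{25/33} \big).$$ -/

import Mathlib

/-- The additive character `ψ_a(x) = e_p(Tr(a x))` of a finite field `F` of characteristic `p`.
Here `Tr` is the trace from `F` to the prime field (so that `Tr(x) = ∑_{i<m} x^(p^i)` when
`|F| = p^m`) and `e_p(x) = exp(2 π i x / p)` is the standard additive character of `ZMod p`. -/
noncomputable def psi (p : ℕ) [Fact p.Prime] {F : Type*} [Field F] [Algebra (ZMod p) F]
    (a x : F) : ℂ :=
  ZMod.stdAddChar (Algebra.trace (ZMod p) F (a * x))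

/-- The incomplete sum `∑_{1 ≤ j ≤ K} ψ_a(g^j)` along the powers of `g`. -/
noncomputable def incSum (p : ℕ) [Fact p.Prime] {F : Type*} [Field F] [Algebra (ZMod p) F]
    (g : Fˣ) (K : ℕ) (a : F) : ℂ :=
  ∑ j ∈ Finset.Icc 1 K, psi p a ((g : F) ^ j)

/-! Write A = {g, ..., g^K} and let E be its additive energy. By orthogonality the fourth moment of
the sums is q E, so the task is to save a power of K, or of q / K, over the trivial bound E ≤ K³.

Put E = K³ / M. The set A is almost multiplicatively closed: the ratios x / (y z) with x, y, z in A
number at most 3K. Additively, a Balog–Szemerédi–Gowers theorem yields a large B ⊆ A with small B -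
B. Pigeonholing over the ratios yields l ≠ 0 and B₁ ⊆ B such that each l a (a ∈ B₁) maps a large
part of B₁ into B, and half of any subset of B into few translates of B. Hence for every r in the
set Q of quotients of differences of B₁ there are large U, V ⊆ B₁ with |U + rV| ≪ M^23 K
(`card_dilate_sum_le`). For r outside Q the sum U + rV is direct and has |U||V| elements.

If Q is not stable under r ↦ r - 1, or under multiplication by l B₁, these facts collide and K ≪
M^32. Otherwise Q contains a subfield L that contains l B₁ (`exists_subfield_of_closed`), and
averaging gives ξ ∈ L \ {0} for which U + ξV must be large (`exists_dilate_small_energy`). If L is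
proper, the gcd hypothesis gives |B₁|² ≪ |L| and again K ≪ M^32; if L is the whole field, either
this holds or q ≪ M^31 K. This is `card_le_of_energy`; solving for E gives the first bound.

For the pointwise bounds, the sum at a and the sum at a g^h differ by two sums of length h. By
induction on K these are small for h ≤ K / 64, so one large value forces many. These are compared
with the fourth moment (second bound), or with a bilinear estimate obtained by three applications of
Cauchy–Schwarz (third bound). -/

open Finset
open scoped Pointwise

/-! ### Balog–Szemerédi–Gowers theorem -/

/-- If the bad pairs in `S × S` number at most `α |S|²`, then at most a proportion `1/4` of the
vertices have more than `4 α |S|` bad neighbours. -/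
theorem card_many_bad_le {G : Type*} (S : Finset G) (bad : G → G → Prop) [DecidableRel bad] {α : ℝ}
    (hα : 0 < α) (h : (#{x ∈ S ×ˢ S | bad x.1 x.2} : ℝ) ≤ α * (#S : ℝ) ^ 2) :
    (#{a ∈ S | 4 * α * #S < (#{b ∈ S | bad a b} : ℝ)} : ℝ) ≤ #S / 4 := by
  rcases S.eq_empty_or_nonempty with rfl | hS
  · simp
  have hS' : (0 : ℝ) < #S := by exact_mod_cast hS.card_pos
  have h1 : (#{x ∈ S ×ˢ S | bad x.1 x.2} : ℝ) = ∑ a ∈ S, (#{b ∈ S | bad a b} : ℝ) := by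
    simp only [card_filter, sum_product]
    push_cast
    rfl
  have h2 : (#{a ∈ S | 4 * α * #S < (#{b ∈ S | bad a b} : ℝ)} : ℝ) * (4 * α * #S)
      ≤ ∑ a ∈ S, (#{b ∈ S | bad a b} : ℝ) := by
    rw [← nsmul_eq_mul]
    refine (card_nsmul_le_sum _ (fun a ↦ (#{b ∈ S | bad a b} : ℝ)) _ ?_).trans
      (sum_le_sum_of_subset_of_nonneg (filter_subset _ _) (by intros; positivity))
    intro a ha
    exact (mem_filter.1 ha).2.le
  rw [← h1] at h2
  have h3 := h2.trans h
  have h4 : (#{a ∈ S | 4 * α * #S < (#{b ∈ S | bad a b} : ℝ)} : ℝ) * (4 * α * #S)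
      ≤ (#S / 4) * (4 * α * #S) := h3.trans (by nlinarith)
  exact le_of_mul_le_mul_right h4 (by positivity)

section Additive

variable {G : Type*} [AddCommGroup G] [DecidableEq G]

/-- The number of representations of `d` as a difference of two elements of `A`. -/
def diffRep (A : Finset G) (d : G) : ℕ := #{a ∈ A | a - d ∈ A}

/-- The additive energy of `A`, as the second moment of `diffRep`. -/
def energy [Fintype G] (A : Finset G) : ℕ := ∑ d, diffRep A d ^ 2

theorem diffRep_le (A : Finset G) (d : G) : diffRep A d ≤ #A := card_filter_le _ _

theorem sum_diffRep [Fintype G] (A : Finset G) : ∑ d, diffRep A d = #A ^ 2 := by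
  simp only [diffRep, card_filter]
  rw [sum_comm]
  have : ∀ a ∈ A, ∑ d : G, (if a - d ∈ A then 1 else 0) = #A := by
    intro a _
    rw [← card_filter]
    refine card_bij (fun d _ ↦ a - d) (by simp) (by simp) (fun b hb ↦ ⟨a - b, by simpa using hb, by simp⟩)
  rw [sum_congr rfl this, sum_const, smul_eq_mul, sq]

/-- The map s ↦ a - s turns shifts into representations of a - b. A pair thus survives in A ∩ (A +
s) for exactly as many s as its difference is popular, so unpopular pairs are rare in a typical A ∩
(A + s). -/
theorem card_common_shift [Fintype G] (A : Finset G) (a b : G) :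
    #{s : G | a - s ∈ A ∧ b - s ∈ A} = diffRep A (a - b) := by
  refine card_bij (fun s _ ↦ a - s) ?_ (by simp) ?_
  · intro s hs
    simp only [mem_filter, mem_univ, true_and] at hs ⊢
    refine ⟨hs.1, ?_⟩
    convert hs.2 using 1
    abel
  · intro x hx
    simp only [mem_filter] at hx
    refine ⟨a - x, ?_, by simp⟩
    simp only [mem_filter, mem_univ, true_and]
    refine ⟨by simpa using hx.1, ?_⟩
    convert hx.2 using 1
    abel

theorem energy_le [Fintype G] (A : Finset G) : energy A ≤ #A ^ 3 := by
  calc energy A ≤ ∑ d, #A * diffRep A d := by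
        refine sum_le_sum fun d _ ↦ ?_
        rw [sq]
        exact Nat.mul_le_mul_right _ (diffRep_le A d)
    _ = #A ^ 3 := by rw [← mul_sum, sum_diffRep]; ring

theorem diffRep_mono {A B : Finset G} (h : A ⊆ B) (d : G) : diffRep A d ≤ diffRep B d := by
  refine card_le_card fun a ha ↦ ?_
  simp only [mem_filter] at ha ⊢
  exact ⟨h ha.1, h ha.2⟩

theorem energy_mono [Fintype G] {A B : Finset G} (h : A ⊆ B) : energy A ≤ energy B :=
  sum_le_sum fun d _ ↦ Nat.pow_le_pow_left (diffRep_mono h d) 2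

theorem card_popular_mul_le [Fintype G] (A : Finset G) (τ : ℝ) :
    (#{d : G | τ ≤ diffRep A d} : ℝ) * τ ≤ (#A : ℝ) ^ 2 := by
  have h1 : (#{d : G | τ ≤ diffRep A d} : ℝ) * τ ≤ ∑ d with τ ≤ diffRep A d, (diffRep A d : ℝ) := by
    rw [← nsmul_eq_mul]
    exact card_nsmul_le_sum _ _ _ (by simp)
  refine h1.trans ?_
  calc ∑ d with τ ≤ diffRep A d, (diffRep A d : ℝ) ≤ ∑ d, (diffRep A d : ℝ) :=
        sum_le_sum_of_subset_of_nonneg (filter_subset _ _) (by intros; positivity)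
    _ = (#A : ℝ) ^ 2 := by exact_mod_cast sum_diffRep A

/-- Over all shifts `s`, the pairs of `A ∩ (A + s)` whose difference is unpopular are few. -/
theorem sum_bad_pairs_le [Fintype G] (A : Finset G) {τ : ℝ} (hτ : 0 ≤ τ) :
    (∑ s : G, #{x ∈ A ×ˢ A | (x.1 - s ∈ A ∧ x.2 - s ∈ A) ∧ (diffRep A (x.1 - x.2) : ℝ) < τ} : ℝ)
      ≤ τ * (#A : ℝ) ^ 2 := by
  have h : (∑ s : G, #{x ∈ A ×ˢ A | (x.1 - s ∈ A ∧ x.2 - s ∈ A) ∧ (diffRep A (x.1 - x.2) : ℝ) < τ})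
      = ∑ x ∈ A ×ˢ A with (diffRep A (x.1 - x.2) : ℝ) < τ, diffRep A (x.1 - x.2) := by
    simp only [card_filter]
    rw [sum_comm, sum_filter]
    refine sum_congr rfl fun x _ ↦ ?_
    split_ifs with hx
    · simp only [hx, and_true]
      rw [← card_common_shift, card_filter]
    · simp [hx]
  rw [← Nat.cast_sum, h, Nat.cast_sum]
  calc (∑ x ∈ A ×ˢ A with (diffRep A (x.1 - x.2) : ℝ) < τ, (diffRep A (x.1 - x.2) : ℝ))
      ≤ ∑ x ∈ A ×ˢ A with (diffRep A (x.1 - x.2) : ℝ) < τ, τ :=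
        sum_le_sum fun x hx ↦ (mem_filter.1 hx).2.le
    _ ≤ ∑ x ∈ A ×ˢ A, τ :=
        sum_le_sum_of_subset_of_nonneg (filter_subset _ _) (by intros; positivity)
    _ = τ * (#A : ℝ) ^ 2 := by simp; ring

/-- Each c turns a - b into (a - c) - (b - c), a difference of two elements of P. So every element
of B - B has at least h representations by pairs from P × P, and distinct differences use distinct
pairs. -/
theorem card_sub_mul_le {B S P : Finset G} {h : ℝ}
    (hB : ∀ a ∈ B, ∀ b ∈ B, h ≤ (#{c ∈ S | a - c ∈ P ∧ b - c ∈ P} : ℝ)) :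
    (#(B - B) : ℝ) * h ≤ (#P : ℝ) ^ 2 := by
  have key : ∀ d ∈ B - B, h ≤ (#{x ∈ P ×ˢ P | x.1 - x.2 = d} : ℝ) := by
    intro d hd
    obtain ⟨a, ha, b, hb, rfl⟩ := mem_sub.1 hd
    refine (hB a ha b hb).trans ?_
    norm_cast
    refine card_le_card_of_injOn (fun c ↦ (a - c, b - c)) ?_ ?_
    · intro c hc
      simp only [coe_filter, Set.mem_ofPred_eq, mem_product] at hc ⊢
      exact ⟨hc.2, by abel⟩
    · intro c _ c' _ hcc
      simpa using congrArg Prod.fst hcc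
  calc (#(B - B) : ℝ) * h ≤ ∑ d ∈ B - B, (#{x ∈ P ×ˢ P | x.1 - x.2 = d} : ℝ) := by
        rw [← nsmul_eq_mul]; exact card_nsmul_le_sum _ _ _ key
    _ ≤ #(P ×ˢ P) := by
        norm_cast
        rw [← card_biUnion]
        · exact card_le_card (biUnion_subset.2 fun d _ ↦ filter_subset _ _)
        · intro d _ d' _ hdd
          rw [Function.onFun, disjoint_left]
          intro x hx hx'
          exact hdd ((mem_filter.1 hx).2.symm.trans (mem_filter.1 hx').2)
    _ = (#P : ℝ) ^ 2 := by rw [card_product]; push_cast; ring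

/-- A form of the Balog–Szemerédi–Gowers theorem with a second, finer, family of popular
differences. -/
theorem balog_szemeredi_gowers [Fintype G] {A : Finset G} (hA : A.Nonempty) {M : ℝ} (hM : 1 ≤ M)
    (hE : (#A : ℝ) ^ 3 ≤ M * energy A) :
    ∃ S ⊆ A, ∃ B ⊆ S, ∃ P : Finset G, (#A : ℝ) / (4 * M) ≤ #S ∧ (#S : ℝ) / 2 ≤ #B ∧
      (#(B - B) : ℝ) * #S ≤ 8192 * M ^ 2 * (#A : ℝ) ^ 2 ∧ (#P : ℝ) ≤ 6144 * M ^ 2 * #A ∧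
      ∀ a ∈ B, (#{b ∈ S | a - b ∉ P} : ℝ) ≤ #S / (384 * M) := by
  have hK : (0 : ℝ) < #A := by exact_mod_cast hA.card_pos
  set K : ℝ := (#A : ℝ) with hKdef
  have hM0 : 0 < M := by linarith
  -- The coarse threshold serves to bound B - B. The finer one makes the exceptional degrees as
  -- small as |S| / (384 M), which must stay below the minimum degree found later in the
  -- multiplicative graph.
  set τ₁ : ℝ := K / (64 * M) with hτ₁
  set τ₂ : ℝ := K / (6144 * M ^ 2) with hτ₂
  have hτ₁0 : 0 < τ₁ := by positivity
  have hτ₂0 : 0 < τ₂ := by positivity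
  set T : G → Finset G := fun s ↦ {a ∈ A | a - s ∈ A} with hT
  set b₁ : G → ℝ := fun s ↦
    #{x ∈ A ×ˢ A | (x.1 - s ∈ A ∧ x.2 - s ∈ A) ∧ (diffRep A (x.1 - x.2) : ℝ) < τ₁} with hb₁
  set b₂ : G → ℝ := fun s ↦
    #{x ∈ A ×ˢ A | (x.1 - s ∈ A ∧ x.2 - s ∈ A) ∧ (diffRep A (x.1 - x.2) : ℝ) < τ₂} with hb₂
  have hs₁ : ∑ s, b₁ s ≤ τ₁ * K ^ 2 := sum_bad_pairs_le A hτ₁0.le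
  have hs₂ : ∑ s, b₂ s ≤ τ₂ * K ^ 2 := sum_bad_pairs_le A hτ₂0.le
  have hsT : ∑ s, (#(T s) : ℝ) = K ^ 2 := by
    have h : ∑ s, #(T s) = #A ^ 2 := sum_diffRep A
    rw [hKdef]
    exact_mod_cast h
  have hsE : ∑ s, (#(T s) : ℝ) ^ 2 = energy A := by simp [energy, diffRep, hT]
  -- The squares sum to the energy, at least K³ / M, while the thresholds are chosen so that each of
  -- the three subtracted terms sums to at most K³ / (4M). A shift s with positive summand has few
  -- bad pairs of both kinds and |T s| > K / (4M) at once.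
  have hpos : 0 < ∑ s, ((#(T s) : ℝ) ^ 2 - 16 * b₁ s - 1536 * M * b₂ s - K / (4 * M) * #(T s)) := by
    simp only [sum_sub_distrib, ← mul_sum]
    rw [hsT, hsE]
    have e1 : K ^ 3 / M ≤ energy A := by rw [div_le_iff₀ hM0]; linarith
    have e2 : 16 * ∑ s, b₁ s ≤ K ^ 3 / M / 4 := by
      calc 16 * ∑ s, b₁ s ≤ 16 * (τ₁ * K ^ 2) := by linarith
        _ = K ^ 3 / M / 4 := by rw [hτ₁]; field_simp; norm_num
    have e3 : 1536 * M * ∑ s, b₂ s ≤ K ^ 3 / M / 4 := by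
      calc 1536 * M * ∑ s, b₂ s ≤ 1536 * M * (τ₂ * K ^ 2) := by gcongr
        _ = K ^ 3 / M / 4 := by rw [hτ₂]; field_simp; norm_num
    have e4 : K / (4 * M) * K ^ 2 = K ^ 3 / M / 4 := by field_simp
    have e5 : 0 < K ^ 3 / M := by positivity
    linarith
  obtain ⟨s, -, hs⟩ := exists_lt_of_sum_lt (s := univ) (f := fun _ : G ↦ (0 : ℝ))
    (g := fun s ↦ (#(T s) : ℝ) ^ 2 - 16 * b₁ s - 1536 * M * b₂ s - K / (4 * M) * #(T s))
    (by simpa using hpos)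
  have hb₁0 : 0 ≤ b₁ s := by positivity
  have hb₂0 : 0 ≤ b₂ s := by positivity
  have hTs : 0 ≤ K / (4 * M) * #(T s) := by positivity
  have hMb₂ : 0 ≤ 1536 * M * b₂ s := by positivity
  have hTpos : (0 : ℝ) < #(T s) := by
    by_contra hcon
    have : (#(T s) : ℝ) = 0 := le_antisymm (not_lt.1 hcon) (by positivity)
    rw [this] at hs
    norm_num at hs
    linarith
  set S := T s with hS
  have hprod : ∀ τ : ℝ, {x ∈ A ×ˢ A | (x.1 - s ∈ A ∧ x.2 - s ∈ A) ∧
      (diffRep A (x.1 - x.2) : ℝ) < τ} = {x ∈ S ×ˢ S | (diffRep A (x.1 - x.2) : ℝ) < τ} := by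
    intro τ
    ext x
    simp only [hS, hT, mem_filter, mem_product]
    tauto
  have hbad₁ : (#{x ∈ S ×ˢ S | (diffRep A (x.1 - x.2) : ℝ) < τ₁} : ℝ) ≤ 1 / 16 * (#S : ℝ) ^ 2 := by
    rw [← hprod]
    change b₁ s ≤ _
    linarith
  have hbad₂ : (#{x ∈ S ×ˢ S | (diffRep A (x.1 - x.2) : ℝ) < τ₂} : ℝ)
      ≤ 1 / (1536 * M) * (#S : ℝ) ^ 2 := by
    rw [← hprod]
    change b₂ s ≤ _
    rw [one_div_mul_eq_div, le_div_iff₀ (by positivity)]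
    linarith
  have hv₁ := card_many_bad_le S (fun a b ↦ (diffRep A (a - b) : ℝ) < τ₁) (by norm_num) hbad₁
  have hv₂ := card_many_bad_le S (fun a b ↦ (diffRep A (a - b) : ℝ) < τ₂) (by positivity) hbad₂
  set V₁ := {a ∈ S | 4 * (1 / 16) * (#S : ℝ) < (#{b ∈ S | (diffRep A (a - b) : ℝ) < τ₁} : ℝ)}
  set V₂ := {a ∈ S | 4 * (1 / (1536 * M)) * (#S : ℝ) < (#{b ∈ S | (diffRep A (a - b) : ℝ) < τ₂} : ℝ)}
  refine ⟨S, filter_subset _ _, S \ (V₁ ∪ V₂), sdiff_subset, ({d : G | τ₂ ≤ diffRep A d} : Finset G),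
    ?_, ?_, ?_, ?_, ?_⟩
  · have : K / (4 * M) * #S < #S * #S := by nlinarith
    exact (lt_of_mul_lt_mul_right this hTpos.le).le
  · have h1 : (#S : ℝ) ≤ #(S \ (V₁ ∪ V₂)) + #(V₁ ∪ V₂) := by
      exact_mod_cast card_le_card_sdiff_add_card
    have h2 : (#(V₁ ∪ V₂) : ℝ) ≤ #V₁ + #V₂ := by exact_mod_cast card_union_le _ _
    linarith
  · have hP := card_popular_mul_le A τ₁
    set P₁ : Finset G := {d : G | τ₁ ≤ diffRep A d} with hP₁
    have hP' : (#P₁ : ℝ) ≤ 64 * M * K := by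
      have : (#P₁ : ℝ) * τ₁ ≤ (64 * M * K) * τ₁ := hP.trans_eq (by rw [hτ₁]; field_simp; rfl)
      exact le_of_mul_le_mul_right this hτ₁0
    -- Each of a and b has at most |S| / 4 bad neighbours, so at least half of S is good for both.
    have hcommon : ∀ a ∈ S \ (V₁ ∪ V₂), ∀ b ∈ S \ (V₁ ∪ V₂),
        (#S : ℝ) / 2 ≤ (#{c ∈ S | a - c ∈ P₁ ∧ b - c ∈ P₁} : ℝ) := by
      have hdeg : ∀ a ∈ S \ (V₁ ∪ V₂), (#{c ∈ S | (diffRep A (a - c) : ℝ) < τ₁} : ℝ) ≤ #S / 4 := by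
        intro a ha
        simp only [mem_sdiff, mem_union, not_or] at ha
        by_contra hcon
        refine ha.2.1 (mem_filter.2 ⟨ha.1, ?_⟩)
        push Not at hcon
        linarith
      intro a ha b hb
      have h1 := hdeg a ha
      have h2 := hdeg b hb
      have h3 : S ⊆ ({c ∈ S | a - c ∈ P₁ ∧ b - c ∈ P₁} ∪ {c ∈ S | (diffRep A (a - c) : ℝ) < τ₁}) ∪
          {c ∈ S | (diffRep A (b - c) : ℝ) < τ₁} := by
        intro c hc
        simp only [hP₁, mem_union, mem_filter, mem_univ, true_and, hc]
        by_cases h : τ₁ ≤ (diffRep A (a - c) : ℝ)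
        · by_cases h' : τ₁ ≤ (diffRep A (b - c) : ℝ)
          · exact Or.inl (Or.inl ⟨h, h'⟩)
          · exact Or.inr (not_le.1 h')
        · exact Or.inl (Or.inr (not_le.1 h))
      have h4 := card_le_card h3
      have h5 := card_union_le ({c ∈ S | a - c ∈ P₁ ∧ b - c ∈ P₁} ∪
        {c ∈ S | (diffRep A (a - c) : ℝ) < τ₁}) {c ∈ S | (diffRep A (b - c) : ℝ) < τ₁}
      have h6 := card_union_le {c ∈ S | a - c ∈ P₁ ∧ b - c ∈ P₁}
        {c ∈ S | (diffRep A (a - c) : ℝ) < τ₁}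
      have h7 : (#S : ℝ) ≤ #{c ∈ S | a - c ∈ P₁ ∧ b - c ∈ P₁} +
        #{c ∈ S | (diffRep A (a - c) : ℝ) < τ₁} + #{c ∈ S | (diffRep A (b - c) : ℝ) < τ₁} := by
        exact_mod_cast h4.trans (h5.trans (by omega))
      linarith
    have h8 := card_sub_mul_le hcommon
    have h9 : (#P₁ : ℝ) ^ 2 ≤ (64 * M * K) ^ 2 := by gcongr
    nlinarith
  · have hP := card_popular_mul_le A τ₂
    have : (#{d : G | τ₂ ≤ diffRep A d} : ℝ) * τ₂ ≤ (6144 * M ^ 2 * K) * τ₂ :=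
      hP.trans_eq (by rw [hτ₂]; field_simp; rfl)
    exact le_of_mul_le_mul_right this hτ₂0
  · intro a ha
    simp only [mem_sdiff, mem_union, not_or] at ha
    by_contra hcon
    refine ha.2.2 (mem_filter.2 ⟨ha.1, ?_⟩)
    push Not at hcon
    have e : 4 * (1 / (1536 * M)) * (#S : ℝ) = #S / (384 * M) := by field_simp; norm_num
    rw [e]
    simpa using hcon

end Additive

/-! ### Minimum degree, greedy covering and Plünnecke inequalities -/

/-- A graph with many edges has a nonempty induced subgraph of large minimum degree. -/
theorem exists_subset_min_degree {α : Type*} [DecidableEq α] (B : Finset α) (r : α → α → Prop)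
    [DecidableRel r] (hr : ∀ a b, r a b → r b a) {θ : ℝ}
    (h : 2 * θ * #B < (#{x ∈ B ×ˢ B | r x.1 x.2} : ℝ)) :
    ∃ B' ⊆ B, B'.Nonempty ∧ ∀ a ∈ B', θ ≤ (#{b ∈ B' | r a b} : ℝ) := by
  -- At a maximiser of f no vertex has degree below θ: deleting it would lose fewer than 2θ ordered
  -- edges and gain 2θ from the second term.
  set f : Finset α → ℝ := fun S ↦ (#{x ∈ S ×ˢ S | r x.1 x.2} : ℝ) - 2 * θ * #S with hf
  obtain ⟨S, hS, hmax⟩ := exists_max_image B.powerset f ⟨B, mem_powerset_self B⟩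
  have hSB := mem_powerset.1 hS
  have hpos : 0 < f S := lt_of_lt_of_le (by simp only [hf]; linarith) (hmax B (mem_powerset_self B))
  refine ⟨S, hSB, ?_, ?_⟩
  · rw [nonempty_iff_ne_empty]
    rintro rfl
    simp [hf] at hpos
  · intro a ha
    by_contra hcon
    push Not at hcon
    have h1 := hmax (S.erase a) (mem_powerset.2 ((erase_subset _ _).trans hSB))
    have hsub : {x ∈ S ×ˢ S | r x.1 x.2} ⊆ {x ∈ (S.erase a) ×ˢ (S.erase a) | r x.1 x.2} ∪
        (({b ∈ S | r a b}.image fun b ↦ (a, b)) ∪ ({b ∈ S | r a b}.image fun b ↦ (b, a))) := by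
      rintro ⟨x, y⟩ hxy
      simp only [mem_filter, mem_product, mem_union, mem_image, mem_erase, Prod.mk.injEq] at hxy ⊢
      by_cases hx : x = a
      · subst hx
        exact Or.inr (Or.inl ⟨y, ⟨hxy.1.2, hxy.2⟩, rfl, rfl⟩)
      · by_cases hy : y = a
        · subst hy
          exact Or.inr (Or.inr ⟨x, ⟨hxy.1.1, hr _ _ hxy.2⟩, rfl, rfl⟩)
        · exact Or.inl ⟨⟨⟨hx, hxy.1.1⟩, hy, hxy.1.2⟩, hxy.2⟩
    have h2 : (#{x ∈ S ×ˢ S | r x.1 x.2} : ℝ) ≤ #{x ∈ (S.erase a) ×ˢ (S.erase a) | r x.1 x.2} +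
        (#{b ∈ S | r a b} + #{b ∈ S | r a b}) := by
      norm_cast
      refine (card_le_card hsub).trans ((card_union_le _ _).trans ?_)
      refine Nat.add_le_add_left ((card_union_le _ _).trans ?_) _
      exact Nat.add_le_add card_image_le card_image_le
    have h3 : (#(S.erase a) : ℝ) = #S - 1 := by
      rw [card_erase_of_mem ha, Nat.cast_sub (card_pos.2 ⟨a, ha⟩)]
      simp
    simp only [hf, h3] at h1
    linarith

section Additive

variable {G : Type*} [AddCommGroup G] [DecidableEq G]

/-- If every element of `Y` has at least `h` differences with `I` in `P`, then half of `Y` is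
covered by few translates of `I`. -/
theorem exists_half_cover (Y I P : Finset G) {h : ℝ} (hh : 0 < h)
    (hY : ∀ y ∈ Y, h ≤ (#{i ∈ I | y - i ∈ P} : ℝ)) :
    ∃ Δ : Finset G, (#Δ : ℝ) ≤ #P / h + 1 ∧ ∃ Y' ⊆ Y, (#Y : ℝ) / 2 ≤ #Y' ∧ Y' ⊆ Δ + I := by
  -- Greedy choice of translates. While less than half of Y is covered, the uncovered part Z has at
  -- least |Y| / 2 elements, and at least |Z| h pairs (y, δ) with δ ∈ P and y - δ ∈ I. The most
  -- frequent δ therefore covers at least h |Y| / (2 |P|) new elements, and ⌈|P| / h⌉ rounds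
  -- suffice.
  have step : ∀ k : ℕ, ∃ Δ : Finset G, #Δ ≤ k ∧ ((#Y : ℝ) / 2 ≤ #(Y ∩ (Δ + I)) ∨
      k * h * #Y ≤ 2 * #P * #(Y ∩ (Δ + I))) := by
    intro k
    induction k with
    | zero => exact ⟨∅, by simp, Or.inr (by simp)⟩
    | succ k ih =>
      obtain ⟨Δ, hΔ, hc | hc⟩ := ih
      · exact ⟨Δ, by omega, Or.inl hc⟩
      by_cases hhalf : (#Y : ℝ) / 2 ≤ #(Y ∩ (Δ + I))
      · exact ⟨Δ, by omega, Or.inl hhalf⟩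
      push Not at hhalf
      set Z := Y \ (Δ + I) with hZ
      have hZc : (#Y : ℝ) / 2 ≤ #Z := by
        have : (#Z : ℝ) + #(Y ∩ (Δ + I)) = #Y := by exact_mod_cast card_sdiff_add_card_inter _ _
        linarith
      have hsum : (#Z : ℝ) * h ≤ ∑ δ ∈ P, (#{y ∈ Z | y - δ ∈ I} : ℝ) := by
        have e1 : ∑ δ ∈ P, (#{y ∈ Z | y - δ ∈ I} : ℝ) = ∑ y ∈ Z, (#{δ ∈ P | y - δ ∈ I} : ℝ) := by
          simp only [card_filter]
          push_cast
          exact sum_comm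
        rw [e1, ← nsmul_eq_mul]
        refine card_nsmul_le_sum _ _ _ fun y hy ↦ (hY y (mem_sdiff.1 hy).1).trans ?_
        norm_cast
        refine card_le_card_of_injOn (fun i ↦ y - i) ?_ (by intro i _ j _ hij; simpa using hij)
        intro i hi
        simp only [coe_filter, Set.mem_ofPred_eq] at hi ⊢
        exact ⟨hi.2, by simpa using hi.1⟩
      rcases P.eq_empty_or_nonempty with rfl | hP
      · refine ⟨Δ, by omega, Or.inr ?_⟩
        simp only [card_empty, Nat.cast_zero, sum_empty] at hsum ⊢
        have : (#Y : ℝ) ≤ 0 := by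
          have : (#Z : ℝ) ≤ 0 := nonpos_of_mul_nonpos_left hsum hh
          linarith
        have hY0 : (#Y : ℝ) = 0 := le_antisymm this (by positivity)
        rw [hY0]
        simp
      obtain ⟨δ, hδ, hmax⟩ := exists_max_image P (fun δ ↦ #{y ∈ Z | y - δ ∈ I}) hP
      have hδ2 : (#Z : ℝ) * h ≤ #P * #{y ∈ Z | y - δ ∈ I} := by
        refine hsum.trans ?_
        rw [← nsmul_eq_mul]
        refine sum_le_card_nsmul _ _ _ fun x hx ↦ ?_
        exact_mod_cast hmax x hx
      refine ⟨insert δ Δ, (card_insert_le _ _).trans (by omega), Or.inr ?_⟩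
      have hunion : (Y ∩ (Δ + I)) ∪ {y ∈ Z | y - δ ∈ I} ⊆ Y ∩ (insert δ Δ + I) := by
        intro y hy
        rcases mem_union.1 hy with hy | hy
        · exact mem_inter.2 ⟨(mem_inter.1 hy).1,
            add_subset_add_right (subset_insert _ _) (mem_inter.1 hy).2⟩
        · obtain ⟨hyZ, hyI⟩ := mem_filter.1 hy
          refine mem_inter.2 ⟨(mem_sdiff.1 hyZ).1, mem_add.2 ⟨δ, mem_insert_self _ _, _, hyI, ?_⟩⟩
          abel
      have hdisj : Disjoint (Y ∩ (Δ + I)) {y ∈ Z | y - δ ∈ I} := by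
        rw [disjoint_left]
        intro y hy hy'
        exact (mem_sdiff.1 (mem_filter.1 hy').1).2 (mem_inter.1 hy).2
      have hcard : (#(Y ∩ (Δ + I)) : ℝ) + #{y ∈ Z | y - δ ∈ I} ≤ #(Y ∩ (insert δ Δ + I)) := by
        rw [← Nat.cast_add, ← card_union_of_disjoint hdisj]
        exact_mod_cast card_le_card hunion
      have h1 : (#Y : ℝ) / 2 * h ≤ #P * #{y ∈ Z | y - δ ∈ I} :=
        (mul_le_mul_of_nonneg_right hZc hh.le).trans hδ2
      have h2 : (#P : ℝ) * (#(Y ∩ (Δ + I)) + #{y ∈ Z | y - δ ∈ I})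
          ≤ #P * #(Y ∩ (insert δ Δ + I)) := by gcongr
      push_cast
      linarith
  obtain ⟨Δ, hΔ, hc⟩ := step ⌈(#P : ℝ) / h⌉₊
  refine ⟨Δ, ?_, Y ∩ (Δ + I), inter_subset_left, ?_, inter_subset_right⟩
  · have : (#Δ : ℝ) ≤ (⌈(#P : ℝ) / h⌉₊ : ℝ) := by exact_mod_cast hΔ
    exact this.trans (Nat.ceil_lt_add_one (by positivity)).le
  · rcases hc with hc | hc
    · exact hc
    · rcases P.eq_empty_or_nonempty with rfl | hP
      · rcases Y.eq_empty_or_nonempty with rfl | ⟨y, hy⟩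
        · simp
        · have := hY y hy
          simp at this
          linarith
      have hP' : (0 : ℝ) < #P := by exact_mod_cast hP.card_pos
      have h1 : (#P : ℝ) ≤ (⌈(#P : ℝ) / h⌉₊ : ℝ) * h := by
        rw [← div_le_iff₀ hh]; exact Nat.le_ceil _
      have h2 : (#P : ℝ) * #Y ≤ 2 * #P * #(Y ∩ (Δ + I)) :=
        (mul_le_mul_of_nonneg_right h1 (by positivity)).trans hc
      have h3 : (#P : ℝ) * #Y ≤ #P * (2 * #(Y ∩ (Δ + I))) := by linarith
      have := le_of_mul_le_mul_left h3 hP'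
      linarith

/-- **Plünnecke's inequality** for two sums with the same summand. -/
theorem exists_subset_card_add_add_mul_sq_le {U : Finset G} (hU : U.Nonempty) (S : Finset G) :
    ∃ X ⊆ U, X.Nonempty ∧ #(X + S + S) * #U ^ 2 ≤ #(U + S) ^ 2 * #X := by
  -- Petridis' choice: X minimises |C + S| / |C| over nonempty C ⊆ U.
  obtain ⟨X, hX, hmin⟩ := exists_min_image (U.powerset.erase ∅)
    (fun C ↦ (#(C + S) : ℚ) / #C) ⟨U, by simp [hU.ne_empty]⟩
  obtain ⟨hXne, hXU⟩ := mem_erase.1 hX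
  rw [mem_powerset] at hXU
  have hXn : X.Nonempty := nonempty_iff_ne_empty.2 hXne
  have hX0 : (0 : ℚ) < #X := by exact_mod_cast hXn.card_pos
  have hU0 : (0 : ℚ) < #U := by exact_mod_cast hU.card_pos
  have hpet : #(S + X + S) * #X ≤ #(X + S) * #(S + X) := by
    refine pluennecke_petridis_inequality_add S fun A' hA' ↦ ?_
    rcases A'.eq_empty_or_nonempty with rfl | hne
    · simp
    have h0 : (0 : ℚ) < #A' := by exact_mod_cast hne.card_pos
    have := hmin A' (mem_erase.2 ⟨hne.ne_empty, mem_powerset.2 (hA'.trans hXU)⟩)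
    rw [div_le_div_iff₀ hX0 h0] at this
    exact_mod_cast this
  have hXS := hmin U (by simp [hU.ne_empty])
  rw [div_le_div_iff₀ hX0 hU0] at hXS
  refine ⟨X, hXU, hXn, ?_⟩
  rw [add_comm S X] at hpet
  have hXS' : #(X + S) * #U ≤ #(U + S) * #X := by exact_mod_cast hXS
  have h2 : (#(X + S + S) * #U ^ 2) * #X ≤ (#(U + S) ^ 2 * #X) * #X := by
    calc (#(X + S + S) * #U ^ 2) * #X = (#(X + S + S) * #X) * #U ^ 2 := by ring
      _ ≤ (#(X + S) * #(X + S)) * #U ^ 2 := Nat.mul_le_mul_right _ hpet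
      _ = (#(X + S) * #U) * (#(X + S) * #U) := by ring
      _ ≤ (#(U + S) * #X) * (#(U + S) * #X) := Nat.mul_le_mul hXS' hXS'
      _ = _ := by ring
  exact Nat.le_of_mul_le_mul_right h2 hXn.card_pos

/-- **Plünnecke's inequality** for two different summands, with an absolute constant. -/
theorem exists_subset_card_add_add_le {U : Finset G} (hU : U.Nonempty) (V W : Finset G) :
    ∃ X ⊆ U, X.Nonempty ∧ #(X + V + W) * #U ^ 2 ≤ 4 * #(U + V) * #(U + W) * #X := by
  rcases V.eq_empty_or_nonempty with rfl | hV
  · exact ⟨U, subset_rfl, hU, by simp⟩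
  rcases W.eq_empty_or_nonempty with rfl | hW
  · exact ⟨U, subset_rfl, hU, by simp⟩
  set v := #(U + V) with hv
  set w := #(U + W) with hw
  have hv0 : 0 < v := (hU.add hV).card_pos
  have hw0 : 0 < w := (hU.add hW).card_pos
  -- To reduce to a single summand, V and W are tagged along independent axes by `E₁` and `E₂`, of
  -- sizes w and v, so that (U + V) × `E₁` and (U + W) × `E₂` both have v w elements. Since |`E₁` +
  -- `E₂`| = w v, the double sum contains w v copies of X + V + W. The factor 4 is the square of the
  -- 2 in |U' + S| ≤ 2 v w.
  set E₁ : Finset (ℤ × ℤ) := (range w).image fun i : ℕ ↦ ((i : ℤ), (0 : ℤ)) with hE₁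
  set E₂ : Finset (ℤ × ℤ) := (range v).image fun i : ℕ ↦ ((0 : ℤ), (i : ℤ)) with hE₂
  have hc₁ : #E₁ = w := by
    rw [hE₁, card_image_of_injective, card_range]
    intro i j h; simpa using h
  have hc₂ : #E₂ = v := by
    rw [hE₂, card_image_of_injective, card_range]
    intro i j h; simpa using h
  have hc : #(E₁ + E₂) = w * v := by
    have : E₁ + E₂ = (range w ×ˢ range v).image fun x ↦ ((x.1 : ℤ), (x.2 : ℤ)) := by
      ext y
      simp only [hE₁, hE₂, mem_add, mem_image, mem_product]
      constructor
      · rintro ⟨_, ⟨i, hi, rfl⟩, _, ⟨j, hj, rfl⟩, h⟩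
        exact ⟨(i, j), ⟨hi, hj⟩, by simpa using h⟩
      · rintro ⟨⟨i, j⟩, ⟨hi, hj⟩, h⟩
        exact ⟨(i, 0), ⟨i, hi, rfl⟩, (0, j), ⟨j, hj, rfl⟩, by simpa using h⟩
    rw [this, card_image_of_injective, card_product, card_range, card_range]
    rintro ⟨i, j⟩ ⟨i', j'⟩ h
    simpa using h
  set U' : Finset (G × ℤ × ℤ) := U ×ˢ {0} with hU'
  set S : Finset (G × ℤ × ℤ) := V ×ˢ E₁ ∪ W ×ˢ E₂ with hS
  have hU'n : U'.Nonempty := hU.product (singleton_nonempty 0)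
  obtain ⟨X', hX'U, hX'n, hX'⟩ := exists_subset_card_add_add_mul_sq_le hU'n S
  set X := X'.image Prod.fst with hX
  have hX'eq : X' = X ×ˢ {0} := by
    ext y
    have h0 : ∀ z ∈ X', z.2 = 0 := fun z hz ↦ mem_singleton.1 (mem_product.1 (hX'U hz)).2
    rw [mem_product, mem_singleton, hX, mem_image]
    constructor
    · exact fun h ↦ ⟨⟨y, h, rfl⟩, h0 y h⟩
    · rintro ⟨⟨z, hz, hzy⟩, hy⟩
      rwa [Prod.ext hzy.symm (hy.trans (h0 z hz).symm)]
  have hXU : X ⊆ U := by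
    intro x hx
    have : (x, (0 : ℤ × ℤ)) ∈ X' := by rw [hX'eq]; simp [hx]
    exact (mem_product.1 (hX'U this)).1
  refine ⟨X, hXU, hX'n.image _, ?_⟩
  have hU'c : #U' = #U := by simp [hU']
  have hX'c : #X' = #X := by rw [hX'eq]; simp
  have hUS : #(U' + S) ≤ 2 * v * w := by
    have : U' + S ⊆ (U + V) ×ˢ E₁ ∪ (U + W) ×ˢ E₂ := by
      rintro ⟨x, e⟩ hx
      obtain ⟨⟨u, e₁⟩, hu, ⟨s, e₂⟩, hs, h⟩ := mem_add.1 hx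
      simp only [hU', hS, mem_product, mem_singleton, mem_union, Prod.mk_add_mk,
        Prod.mk.injEq] at hu hs h ⊢
      obtain ⟨hu, rfl⟩ := hu
      obtain ⟨rfl, rfl⟩ := h
      rcases hs with hs | hs
      · exact Or.inl ⟨add_mem_add hu hs.1, by simpa using hs.2⟩
      · exact Or.inr ⟨add_mem_add hu hs.1, by simpa using hs.2⟩
    refine (card_le_card this).trans ((card_union_le _ _).trans ?_)
    rw [card_product, card_product, hc₁, hc₂, ← hv, ← hw]
    nlinarith
  have hXS : #(X + V + W) * (w * v) ≤ #(X' + S + S) := by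
    rw [← hc, ← card_product]
    refine card_le_card ?_
    rintro ⟨x, e⟩ hx
    obtain ⟨hx, he⟩ := mem_product.1 hx
    obtain ⟨y, hy, z, hz, rfl⟩ := mem_add.1 hx
    obtain ⟨x, hx', t, ht, rfl⟩ := mem_add.1 hy
    obtain ⟨e₁, he₁, e₂, he₂, rfl⟩ := mem_add.1 he
    refine mem_add.2 ⟨(x + t, e₁), mem_add.2 ⟨(x, 0), ?_, (t, e₁), ?_, by simp⟩, (z, e₂), ?_, rfl⟩
    · rw [hX'eq]; simpa using hx'
    · exact mem_union_left _ (mem_product.2 ⟨ht, he₁⟩)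
    · exact mem_union_right _ (mem_product.2 ⟨hz, he₂⟩)
  rw [hU'c, hX'c] at hX'
  have h1 : (#(X + V + W) * #U ^ 2) * (w * v) ≤ (4 * v * w * #X) * (w * v) := by
    calc (#(X + V + W) * #U ^ 2) * (w * v) = (#(X + V + W) * (w * v)) * #U ^ 2 := by ring
      _ ≤ #(X' + S + S) * #U ^ 2 := Nat.mul_le_mul_right _ hXS
      _ ≤ #(U' + S) ^ 2 * #X := hX'
      _ ≤ (2 * v * w) ^ 2 * #X := Nat.mul_le_mul_right _ (Nat.pow_le_pow_left hUS 2)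
      _ = _ := by ring
  exact Nat.le_of_mul_le_mul_right h1 (Nat.mul_pos hw0 hv0)

end Additive

/-! ### Subfields and quotients of differences -/

section Field

variable {F : Type*} [Field F]

/-- In a finite field, a set which contains `0` and is closed under negation, under subtraction of
`1` and under multiplication by the elements of `T` contains the subfield generated by `T`. -/
theorem exists_subfield_of_closed [Fintype F] (T Q : Set F) (h0 : (0 : F) ∈ Q) (hneg : ∀ r ∈ Q, -r ∈ Q)
    (hone : ∀ r ∈ Q, r - 1 ∈ Q) (hmul : ∀ x ∈ T, ∀ r ∈ Q, x * r ∈ Q) :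
    ∃ L : Subfield F, T ⊆ L ∧ (L : Set F) ⊆ Q := by
  -- In a finite field inverses are powers, so the monoid generated by T is closed under inverting
  -- nonzero elements.
  have hinv : ∀ x : F, x ≠ 0 → x⁻¹ = x ^ (Fintype.card F - 2) := by
    intro x hx
    have hc : 1 < Fintype.card F := Fintype.one_lt_card
    refine (eq_inv_of_mul_eq_one_left ?_).symm
    rw [← pow_succ, show Fintype.card F - 2 + 1 = Fintype.card F - 1 by omega]
    exact FiniteField.pow_card_sub_one_eq_one x hx
  have hmon : ∀ y ∈ Submonoid.closure T, ∀ r ∈ Q, y * r ∈ Q := by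
    intro y hy
    induction hy using Submonoid.closure_induction with
    | mem x hx => exact hmul x hx
    | one => simp
    | mul x y _ _ hx hy => intro r hr; rw [mul_assoc]; exact hx _ (hy r hr)
  -- Translation by y reduces to translation by 1 through r + y = y (y⁻¹ r + 1), and r + 1 = -((-r)
  -- - 1).
  have hmon' : ∀ y ∈ Submonoid.closure T, ∀ r ∈ Q, r + y ∈ Q := by
    intro y hy r hr
    rcases eq_or_ne y 0 with rfl | hy0
    · simpa using hr
    have h1 : y⁻¹ * r ∈ Q := by
      rw [hinv y hy0]
      exact hmon _ (pow_mem hy _) r hr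
    have h2 : y⁻¹ * r + 1 ∈ Q := by
      have := hneg _ (hone _ (hneg _ h1))
      convert this using 1
      ring
    have h3 := hmon y hy _ h2
    rwa [mul_add, mul_inv_cancel_left₀ hy0, mul_one] at h3
  have hadd : ∀ y ∈ AddSubgroup.closure (Submonoid.closure T : Set F), ∀ r ∈ Q, r + y ∈ Q := by
    intro y hy
    induction hy using AddSubgroup.closure_induction with
    | mem x hx => exact hmon' x hx
    | zero => simp
    | add x y _ _ hx hy => intro r hr; rw [← add_assoc]; exact hy _ (hx r hr)
    | neg x _ hx =>
      intro r hr
      have := hneg _ (hx _ (hneg r hr))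
      convert this using 1
      ring
  refine ⟨{ Subring.closure T with
    inv_mem' := fun x hx ↦ by
      rcases eq_or_ne x 0 with rfl | hx0
      · simp
      · rw [hinv x hx0]; exact (Subring.closure T).pow_mem hx _ }, Subring.subset_closure, ?_⟩
  intro y hy
  have := hadd y (Subring.mem_closure_iff.1 hy) 0 h0
  simpa using this

variable [DecidableEq F]

/-- Some nonzero dilate by an element of a subfield has small additive energy with the given set. -/
theorem exists_dilate_small_energy [Fintype F] (L : Subfield F) (B : Finset F) :
    ∃ ξ ∈ L, ξ ≠ 0 ∧ ((B.addEnergy (B.image (ξ * ·)) : ℕ) : ℝ) ≤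
      (#B : ℝ) ^ 2 + (#B : ℝ) ^ 4 / ((Nat.card L : ℝ) - 1) := by
  classical
  set X : Finset F := {ξ | ξ ∈ L ∧ ξ ≠ 0} with hX
  have hXc : (#X : ℝ) = (Nat.card L : ℝ) - 1 := by
    have h1 : insert 0 X = ({ξ | ξ ∈ L} : Finset F) := by
      ext ξ
      simp only [hX, mem_insert, mem_filter, mem_univ, true_and]
      constructor
      · rintro (rfl | h)
        · exact L.zero_mem
        · exact h.1
      · intro h
        by_cases h0 : ξ = 0
        · exact Or.inl h0
        · exact Or.inr ⟨h, h0⟩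
    have h2 : Nat.card L = #({ξ | ξ ∈ L} : Finset F) := by
      rw [Nat.card_eq_fintype_card, Fintype.card_subtype]
    rw [h2, ← h1, card_insert_of_notMem (by simp [hX])]
    simp
  have hXn : X.Nonempty := ⟨1, by simp [hX]⟩
  have hX0 : (0 : ℝ) < #X := by exact_mod_cast hXn.card_pos
  set e : F → ℕ := fun ξ ↦ #{x ∈ (B ×ˢ B) ×ˢ (B ×ˢ B) | x.1.1 + ξ * x.2.1 = x.1.2 + ξ * x.2.2} with he
  have hE : ∀ ξ ∈ X, B.addEnergy (B.image (ξ * ·)) ≤ e ξ := by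
    intro ξ hξ
    unfold addEnergy
    have : ({x ∈ (B ×ˢ B) ×ˢ (B.image (ξ * ·)) ×ˢ (B.image (ξ * ·)) |
        x.1.1 + x.2.1 = x.1.2 + x.2.2} : Finset _) ⊆
        ({x ∈ (B ×ˢ B) ×ˢ (B ×ˢ B) | x.1.1 + ξ * x.2.1 = x.1.2 + ξ * x.2.2}).image
          fun x ↦ (x.1, (ξ * x.2.1, ξ * x.2.2)) := by
      rintro ⟨⟨a, b⟩, c, d⟩ hx
      simp only [mem_filter, mem_product, mem_image] at hx
      obtain ⟨⟨hab, ⟨c', hc', rfl⟩, d', hd', rfl⟩, h⟩ := hx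
      refine mem_image.2 ⟨((a, b), (c', d')), ?_, rfl⟩
      simp only [mem_filter, mem_product]
      exact ⟨⟨hab, hc', hd'⟩, h⟩
    exact (card_le_card this).trans card_image_le
  -- A quadruple solves its equation for at most one ξ unless the two entries multiplied by ξ agree;
  -- in that case the other two must agree as well, which leaves |B|² quadruples.
  have hsum : ∑ ξ ∈ X, e ξ ≤ #X * #B ^ 2 + #B ^ 4 := by
    simp only [he, card_filter]
    rw [sum_comm]
    have hpt : ∀ x ∈ (B ×ˢ B) ×ˢ (B ×ˢ B),
        (∑ ξ ∈ X, if x.1.1 + ξ * x.2.1 = x.1.2 + ξ * x.2.2 then 1 else 0) ≤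
          #X * (if x.1.1 = x.1.2 ∧ x.2.1 = x.2.2 then 1 else 0) + 1 := by
      intro x _
      rw [← card_filter]
      by_cases h2 : x.2.1 = x.2.2
      · by_cases h1 : x.1.1 = x.1.2
        · simp only [h1, h2, and_self, if_true, mul_one]
          exact (card_filter_le _ _).trans (Nat.le_succ _)
        · simp [h1, h2]
      · refine le_trans (card_le_one.2 ?_) (Nat.le_add_left 1 _)
        intro a ha b hb
        have ha' := (mem_filter.1 ha).2
        have hb' := (mem_filter.1 hb).2
        have : (a - b) * (x.2.1 - x.2.2) = 0 := by linear_combination ha' - hb'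
        rcases mul_eq_zero.1 this with h | h
        · exact sub_eq_zero.1 h
        · exact absurd (sub_eq_zero.1 h) h2
    refine (sum_le_sum hpt).trans ?_
    rw [sum_add_distrib, ← mul_sum, ← card_filter]
    have hd : #{x ∈ (B ×ˢ B) ×ˢ (B ×ˢ B) | x.1.1 = x.1.2 ∧ x.2.1 = x.2.2} ≤ #B ^ 2 := by
      rw [sq, ← card_product]
      refine card_le_card_of_injOn (fun x ↦ (x.1.1, x.2.1)) ?_ ?_
      · intro x hx
        simp only [coe_filter, mem_product, Set.mem_ofPred_eq] at hx
        simp [hx.1]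
      · rintro ⟨⟨a, b⟩, c, d⟩ hx ⟨⟨a', b'⟩, c', d'⟩ hx' h
        simp only [coe_filter, Set.mem_ofPred_eq, Prod.mk.injEq] at hx hx' h ⊢
        obtain ⟨-, rfl, rfl⟩ := hx
        obtain ⟨-, rfl, rfl⟩ := hx'
        exact ⟨⟨h.1, h.1⟩, h.2, h.2⟩
    have hall : ∑ _x ∈ (B ×ˢ B) ×ˢ (B ×ˢ B), 1 = #B ^ 4 := by
      simp only [sum_const, card_product, smul_eq_mul, mul_one]
      ring
    rw [hall]
    gcongr
  obtain ⟨ξ, hξ, hmin⟩ := exists_min_image X e hXn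
  have h1 : #X * e ξ ≤ ∑ ξ ∈ X, e ξ := by
    rw [← smul_eq_mul]
    exact card_nsmul_le_sum _ _ _ hmin
  have h2 : (#X : ℝ) * e ξ ≤ #X * (#B : ℝ) ^ 2 + (#B : ℝ) ^ 4 := by exact_mod_cast h1.trans hsum
  obtain ⟨hξL, hξ0⟩ := (mem_filter.1 hξ).2
  refine ⟨ξ, hξL, hξ0, ?_⟩
  have h3 : ((B.addEnergy (B.image (ξ * ·)) : ℕ) : ℝ) ≤ e ξ := by exact_mod_cast hE ξ hξ
  refine h3.trans ?_
  rw [← hXc, ← sub_le_iff_le_add', le_div_iff₀ hX0]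
  linarith

/-- Multiplying by l (c - d) clears the denominator: u + s ((a - e) / (c - d)) y becomes l c u - l d
u + l a s y - l e s y, and each of the four terms lies in B or in a few translates of it. The factor
s allows a further dilation of Y. -/
theorem card_dilate_sum_le {U Y B Δ₁ Δ₂ Δ₃ : Finset F} {a c d e s l : F} (hl : l ≠ 0) (hcd : c ≠ d)
    (hc : ∀ u ∈ U, l * c * u ∈ B) (hd : ∀ u ∈ U, l * d * u ∈ Δ₁ + B)
    (ha : ∀ y ∈ Y, l * a * (s * y) ∈ Δ₂ + B) (he : ∀ y ∈ Y, l * e * (s * y) ∈ Δ₃ + B) :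
    #(U + Y.image (s * ((a - e) / (c - d)) * ·)) ≤ #Δ₁ * #Δ₂ * #Δ₃ * #(2 • B - 2 • B) := by
  have hk : l * (c - d) ≠ 0 := mul_ne_zero hl (sub_ne_zero.2 hcd)
  have hcd' : c - d ≠ 0 := sub_ne_zero.2 hcd
  rw [← card_image_of_injective (U + Y.image (s * ((a - e) / (c - d)) * ·)) (mul_right_injective₀ hk)]
  have hsub : (U + Y.image (s * ((a - e) / (c - d)) * ·)).image (l * (c - d) * ·) ⊆
      (Δ₂ - Δ₁ - Δ₃) + (2 • B - 2 • B) := by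
    intro z hz
    obtain ⟨w, hw, rfl⟩ := mem_image.1 hz
    obtain ⟨u, hu, v, hv, rfl⟩ := mem_add.1 hw
    obtain ⟨y, hy, rfl⟩ := mem_image.1 hv
    obtain ⟨δ₁, h₁, b₁, hb₁, e₁⟩ := mem_add.1 (hd u hu)
    obtain ⟨δ₂, h₂, b₂, hb₂, e₂⟩ := mem_add.1 (ha y hy)
    obtain ⟨δ₃, h₃, b₃, hb₃, e₃⟩ := mem_add.1 (he y hy)
    refine mem_add.2 ⟨δ₂ - δ₁ - δ₃, sub_mem_sub (sub_mem_sub h₂ h₁) h₃,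
      (l * c * u + b₂) - (b₁ + b₃), ?_, ?_⟩
    · rw [two_nsmul]
      exact sub_mem_sub (add_mem_add (hc u hu) hb₂) (add_mem_add hb₁ hb₃)
    · field_simp
      linear_combination -e₁ + e₂ - e₃
  refine (card_le_card hsub).trans (card_add_le.trans ?_)
  gcongr
  calc #(Δ₂ - Δ₁ - Δ₃) ≤ #(Δ₂ - Δ₁) * #Δ₃ := card_sub_le
    _ ≤ (#Δ₂ * #Δ₁) * #Δ₃ := Nat.mul_le_mul_right _ card_sub_le
    _ = _ := by ring

/-- The set of quotients of differences of elements of `B`. -/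
def quotSet (B : Finset F) : Set F :=
  {ξ | ∃ a ∈ B, ∃ e ∈ B, ∃ c ∈ B, ∃ d ∈ B, c ≠ d ∧ ξ = (a - e) / (c - d)}

/-- A collision u + ξ y = u' + ξ y' with y ≠ y' would exhibit ξ as (u' - u) / (y - y'). -/
theorem card_add_image_of_notMem_quotSet {B U Y : Finset F} {ξ : F} (hξ : ξ ∉ quotSet B)
    (hU : U ⊆ B) (hY : Y ⊆ B) : #(U + Y.image (ξ * ·)) = #U * #Y := by
  have : U + Y.image (ξ * ·) = (U ×ˢ Y).image fun x ↦ x.1 + ξ * x.2 := by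
    ext z
    simp only [mem_add, mem_image, mem_product, Prod.exists]
    constructor
    · rintro ⟨u, hu, _, ⟨y, hy, rfl⟩, h⟩
      exact ⟨u, y, ⟨hu, hy⟩, h⟩
    · rintro ⟨u, y, ⟨hu, hy⟩, h⟩
      exact ⟨u, hu, _, ⟨y, hy, rfl⟩, h⟩
  rw [this, card_image_of_injOn, card_product]
  rintro ⟨u, y⟩ h ⟨u', y'⟩ h' huy
  obtain ⟨hu, hy⟩ := mem_product.1 h
  obtain ⟨hu', hy'⟩ := mem_product.1 h'
  simp only at hu hy hu' hy' huy
  by_cases hyy : y = y'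
  · subst hyy
    simpa using huy
  · refine absurd ⟨u', hU hu', u, hU hu, y, hY hy, y', hY hy', hyy, ?_⟩ hξ
    rw [eq_div_iff (sub_ne_zero.2 hyy)]
    linear_combination huy

end Field

/-! ### A subset with additive and multiplicative structure -/

section Field

variable {F : Type*} [Field F] [DecidableEq F]

/-- Pigeonholing over the dilates: some `l` maps many products `a a'` of pairs from `B` into `B`. -/
theorem exists_popular_dilate {A B : Finset F} (hA0 : (0 : F) ∉ A) (hBA : B ⊆ A) (hB : B.Nonempty)
    (hmul : #((A ×ˢ A ×ˢ A).image fun x ↦ x.1 / (x.2.1 * x.2.2)) ≤ 3 * #A) :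
    ∃ l : F, l ≠ 0 ∧
      (#B : ℝ) ^ 3 ≤ 3 * #A * (#{x ∈ B ×ˢ B | l * x.1 * x.2 ∈ B} : ℝ) := by
  set R := (A ×ˢ A ×ˢ A).image fun x ↦ x.1 / (x.2.1 * x.2.2) with hR
  have hne : ∀ x ∈ A, x ≠ 0 := fun x hx h ↦ hA0 (h ▸ hx)
  have hRn : R.Nonempty := by
    obtain ⟨b, hb⟩ := hB
    exact ⟨_, mem_image.2 ⟨(b, b, b), by simp [hBA hb], rfl⟩⟩
  let f : F → ℕ := fun l ↦ #{x ∈ B ×ˢ B | l * x.1 * x.2 ∈ B}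
  obtain ⟨l, hl, hmax⟩ := exists_max_image R f hRn
  refine ⟨l, ?_, ?_⟩
  · obtain ⟨⟨x, y, z⟩, hx, rfl⟩ := mem_image.1 hl
    simp only [mem_product] at hx
    exact div_ne_zero (hne x hx.1) (mul_ne_zero (hne y hx.2.1) (hne z hx.2.2))
  · have h1 : #(B ×ˢ B ×ˢ B) ≤ ∑ l ∈ R, #{x ∈ B ×ˢ B | l * x.1 * x.2 ∈ B} := by
      rw [← card_sigma]
      refine card_le_card_of_injOn (fun x ↦ ⟨x.1 / (x.2.1 * x.2.2), x.2⟩) ?_ ?_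
      · rintro ⟨x, y, z⟩ hx
        simp only [coe_product, Set.mem_prod, mem_coe] at hx
        obtain ⟨hx, hy, hz⟩ := hx
        have hy0 := hne y (hBA hy)
        have hz0 := hne z (hBA hz)
        simp only [coe_sigma, Set.mem_sigma_iff, mem_coe, mem_filter, mem_product]
        refine ⟨mem_image.2 ⟨(x, y, z), by simp [hBA hx, hBA hy, hBA hz], rfl⟩, ⟨hy, hz⟩, ?_⟩
        convert hx using 1
        field_simp
      · rintro ⟨x, y, z⟩ hx ⟨x', y', z'⟩ hx' h
        simp only [coe_product, Set.mem_prod, mem_coe] at hx hx'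
        simp only [Sigma.mk.injEq, heq_eq_eq, Prod.mk.injEq] at h
        obtain ⟨h, rfl, rfl⟩ := h
        have hy0 := hne y (hBA hx.2.1)
        have hz0 := hne z (hBA hx.2.2)
        rw [div_left_inj' (mul_ne_zero hy0 hz0)] at h
        rw [h]
    have h2 : ∑ l ∈ R, #{x ∈ B ×ˢ B | l * x.1 * x.2 ∈ B}
        ≤ #R * #{x ∈ B ×ˢ B | l * x.1 * x.2 ∈ B} := by
      rw [← smul_eq_mul]
      exact sum_le_card_nsmul _ _ _ hmax
    have h3 := (h1.trans h2).trans (Nat.mul_le_mul_right _ hmul)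
    rw [card_product, card_product] at h3
    have h4 : (#B : ℝ) * (#B * #B) ≤ 3 * #A * (#{x ∈ B ×ˢ B | l * x.1 * x.2 ∈ B} : ℝ) := by
      exact_mod_cast h3
    linarith

/-- A set of large additive energy which is close to being multiplicatively closed contains a subset
`B` of small doubling together with `B₁ ⊆ B` such that the dilates of `B` by elements of `l B₁` are
efficiently covered by translates of `B`. -/
theorem exists_structured_subset [Fintype F] {A : Finset F} (hA0 : (0 : F) ∉ A) (hA : A.Nonempty)
    (hmul : #((A ×ˢ A ×ˢ A).image fun x ↦ x.1 / (x.2.1 * x.2.2)) ≤ 3 * #A) {M : ℝ} (hM : 1 ≤ M)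
    (hE : (#A : ℝ) ^ 3 ≤ M * energy A) :
    ∃ B ⊆ A, ∃ l : F, l ≠ 0 ∧ ∃ B₁ ⊆ B, B₁.Nonempty ∧ ∃ θ : ℝ, (#A : ℝ) / (768 * M ^ 2) ≤ θ ∧
      (∀ a ∈ B₁, θ ≤ (#{y ∈ B₁ | l * a * y ∈ B} : ℝ)) ∧
      (∀ a ∈ B₁, ∀ Y ⊆ B, ∃ Y' ⊆ Y, ∃ Δ : Finset F, (#Y : ℝ) / 2 ≤ #Y' ∧
        (#Δ : ℝ) ≤ 10 ^ 7 * M ^ 4 ∧ ∀ y ∈ Y', l * a * y ∈ Δ + B) ∧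
      (#(B - B) : ℝ) ≤ 2 ^ 15 * M ^ 3 * #A ∧ (#(2 • B - 2 • B) : ℝ) ≤ 2 ^ 69 * M ^ 15 * #A := by
  obtain ⟨S, hSA, B, hBS, P, hS, hBc, hBB, hP, hgood⟩ := balog_szemeredi_gowers hA hM hE
  have hM0 : 0 < M := by linarith
  have hK : (0 : ℝ) < #A := by exact_mod_cast hA.card_pos
  have hn : (0 : ℝ) < #S := lt_of_lt_of_le (by positivity) hS
  have hN : (0 : ℝ) < #B := lt_of_lt_of_le (by positivity) hBc
  have hBn : B.Nonempty := card_pos.1 (by exact_mod_cast hN)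
  have hBA := hBS.trans hSA
  obtain ⟨l, hl, hpairs⟩ := exists_popular_dilate hA0 hBA hBn hmul
  -- A quarter of the guaranteed average degree |B|² / (3 |A|); the strict edge count required for
  -- minimum degree θ then has a factor 2 to spare.
  set θ : ℝ := (#B : ℝ) ^ 2 / (12 * #A) with hθ
  have hSM : (#A : ℝ) ≤ 4 * M * #S := by
    rw [div_le_iff₀ (by positivity)] at hS; linarith
  have hθ1 : (#S : ℝ) / (384 * M) ≤ θ / 2 := by
    rw [hθ, div_div, div_le_div_iff₀ (by positivity) (by positivity)]
    calc (#S : ℝ) * (12 * #A * 2) ≤ #S * (12 * (4 * M * #S) * 2) := by gcongr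
      _ = 384 * M * ((#S : ℝ) / 2) ^ 2 := by ring
      _ ≤ 384 * M * (#B : ℝ) ^ 2 := by gcongr
      _ = _ := by ring
  have hθ2 : (#A : ℝ) / (768 * M ^ 2) ≤ θ := by
    have : (#A : ℝ) / (768 * M ^ 2) = (#A : ℝ) / (4 * M) / (384 * M) * 2 := by field_simp; norm_num
    rw [this]
    have : (#A : ℝ) / (4 * M) / (384 * M) ≤ #S / (384 * M) := by gcongr
    linarith
  have hθ0 : 0 < θ := lt_of_lt_of_le (by positivity) hθ2
  obtain ⟨B₁, hB₁B, hB₁n, hdeg⟩ := exists_subset_min_degree B (fun a b ↦ l * a * b ∈ B)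
    (fun a b h ↦ by rwa [mul_right_comm]) (θ := θ) (by
      have h1 : 2 * θ * #B * (6 * #A) = (#B : ℝ) ^ 3 := by rw [hθ]; field_simp; norm_num
      have h3 : (0 : ℝ) < (#B : ℝ) ^ 3 := by positivity
      nlinarith)
  refine ⟨B, hBA, l, hl, B₁, hB₁B, hB₁n, θ, hθ2, hdeg, ?_, ?_, ?_⟩
  · intro a ha Y hY
    set I := {y ∈ B₁ | l * a * y ∈ B} with hI
    have hIθ : θ ≤ #I := hdeg a ha
    -- I has at least θ elements, and at most |S| / (384 M) ≤ θ / 2 of them have an unpopular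
    -- difference with y. Hence few translates of I cover half of Y, and dilation by l a sends I
    -- into B.
    have hcov : ∀ y ∈ Y, θ / 2 ≤ (#{i ∈ I | y - i ∈ P} : ℝ) := by
      intro y hy
      have h1 := hgood y (hY hy)
      have h2 : (#I : ℝ) ≤ #{i ∈ I | y - i ∈ P} + #{b ∈ S | y - b ∉ P} := by
        norm_cast
        refine le_trans (card_le_card ?_) (card_union_le _ _)
        intro i hi
        by_cases h : y - i ∈ P
        · exact mem_union_left _ (mem_filter.2 ⟨hi, h⟩)
        · exact mem_union_right _ (mem_filter.2 ⟨hBS (hB₁B (mem_filter.1 hi).1), h⟩)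
      linarith
    obtain ⟨Δ, hΔ, Y', hY', hY'c, hY'Δ⟩ := exists_half_cover Y I P (half_pos hθ0) hcov
    refine ⟨Y', hY', Δ.image (l * a * ·), hY'c, ?_, ?_⟩
    · have h1 : (#(Δ.image (l * a * ·)) : ℝ) ≤ #Δ := by exact_mod_cast card_image_le
      have h2 : (#P : ℝ) / (θ / 2) ≤ 9437184 * M ^ 4 := by
        rw [div_le_iff₀ (by positivity)]
        calc (#P : ℝ) ≤ 6144 * M ^ 2 * #A := hP
          _ = 9437184 * M ^ 4 * ((#A : ℝ) / (768 * M ^ 2) / 2) := by field_simp; norm_num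
          _ ≤ 9437184 * M ^ 4 * (θ / 2) := by gcongr
      have h3 : 1 ≤ M ^ 4 := one_le_pow₀ hM
      linarith
    · intro y hy
      obtain ⟨δ, hδ, i, hi, rfl⟩ := mem_add.1 (hY'Δ hy)
      rw [mul_add]
      exact add_mem_add (mem_image_of_mem _ hδ) (mem_filter.1 hi).2
  · have h1 : (#(B - B) : ℝ) * #S ≤ (2 ^ 15 * M ^ 3 * #A) * #S := by
      refine hBB.trans ?_
      calc 8192 * M ^ 2 * (#A : ℝ) ^ 2 = 8192 * M ^ 2 * #A * #A := by ring
        _ ≤ 8192 * M ^ 2 * #A * (4 * M * #S) := by gcongr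
        _ = _ := by ring
    exact le_of_mul_le_mul_right h1 hn
  · have hpr := pluennecke_ruzsa_inequality_nsmul_sub_nsmul_sub hBn B 2 2
    have hpr' : (#(2 • B - 2 • B) : ℝ) ≤ ((#(B - B) : ℝ) / #B) ^ 4 * #B := by
      have := (NNRat.cast_le (K := ℝ)).2 hpr
      push_cast at this
      exact this
    refine hpr'.trans ?_
    have h1 : (#(B - B) : ℝ) / #B * #B = #(B - B) := div_mul_cancel₀ _ hN.ne'
    have h2 : ((#(B - B) : ℝ) / #B) ^ 4 * #B = (#(B - B) : ℝ) ^ 4 / (#B : ℝ) ^ 3 := by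
      field_simp
    rw [h2, div_le_iff₀ (by positivity)]
    have h3 : (#(B - B) : ℝ) ≤ 8192 * M ^ 2 * (#A : ℝ) ^ 2 / #S := by rwa [le_div_iff₀ hn]
    have h5 : (#A : ℝ) ^ 7 ≤ (4 * M * #S) ^ 7 := by gcongr
    calc (#(B - B) : ℝ) ^ 4 ≤ (8192 * M ^ 2 * (#A : ℝ) ^ 2 / #S) ^ 4 := by gcongr
      _ = 2 ^ 52 * M ^ 8 * #A / (#S : ℝ) ^ 4 * (#A : ℝ) ^ 7 := by
        field_simp; norm_num
      _ ≤ 2 ^ 52 * M ^ 8 * #A / (#S : ℝ) ^ 4 * (4 * M * #S) ^ 7 := by gcongr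
      _ = 2 ^ 69 * M ^ 15 * #A * ((#S : ℝ) / 2) ^ 3 := by field_simp; norm_num
      _ ≤ 2 ^ 69 * M ^ 15 * #A * (#B : ℝ) ^ 3 := by gcongr

end Field

/-! ### The energy dichotomy -/

section Field

variable {F : Type*} [Field F] [DecidableEq F]

set_option maxHeartbeats 2000000 in
/-- A lower bound for the loss `M` in the additive energy `|A|³ / M` of a nearly multiplicatively
closed subset `A` of a finite field which does not concentrate on dilates of subfields. -/
theorem card_le_of_energy [Fintype F] {A : Finset F} (hA0 : (0 : F) ∉ A) (hA : A.Nonempty)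
    (hmul : #((A ×ˢ A ×ˢ A).image fun x ↦ x.1 / (x.2.1 * x.2.2)) ≤ 3 * #A) {C₀ : ℝ}
    (hsub : ∀ L : Subfield F, L ≠ ⊤ → ∀ l : F, l ≠ 0 → ∀ B ⊆ A, (∀ b ∈ B, l * b ∈ L) →
      (#B : ℝ) ^ 2 ≤ C₀ ^ 2 * Nat.card L)
    {M : ℝ} (hM : 1 ≤ M) (hE : (#A : ℝ) ^ 3 ≤ M * energy A) :
    (#A : ℝ) ≤ 2 ^ 165 * (1 + 2 * C₀ ^ 2) * M ^ 32 ∨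
      (Fintype.card F : ℝ) ≤ 2 ^ 161 * M ^ 31 * #A := by
  have hM0 : 0 < M := by linarith
  have hK : (0 : ℝ) < #A := by exact_mod_cast hA.card_pos
  have hM32 : ∀ k ≤ 32, M ^ k ≤ M ^ 32 := fun k hk ↦ pow_le_pow_right₀ hM hk
  have hC : 1 ≤ 1 + 2 * C₀ ^ 2 := by nlinarith [sq_nonneg C₀]
  have hfin : ∀ (c : ℝ) (k : ℕ), c ≤ 2 ^ 165 → k ≤ 32 → (#A : ℝ) ≤ c * M ^ k →
      (#A : ℝ) ≤ 2 ^ 165 * (1 + 2 * C₀ ^ 2) * M ^ 32 := by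
    intro c k hc hk h
    calc (#A : ℝ) ≤ c * M ^ k := h
      _ ≤ 2 ^ 165 * M ^ 32 := by
        have := hM32 k hk
        gcongr
      _ = 2 ^ 165 * 1 * M ^ 32 := by ring
      _ ≤ 2 ^ 165 * (1 + 2 * C₀ ^ 2) * M ^ 32 := by gcongr
  obtain ⟨B, hBA, l, hl, B₁, hB₁B, hB₁n, θ, hθ, hdeg, hcov, hBB, h2B⟩ :=
    exists_structured_subset hA0 hA hmul hM hE
  have hB0 : ∀ b ∈ B, b ≠ 0 := fun b hb h ↦ hA0 (h ▸ hBA hb)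
  have hθ0 : 0 < θ := lt_of_lt_of_le (by positivity) hθ
  by_cases hone : #B₁ ≤ 1
  · left
    obtain ⟨a, ha⟩ := hB₁n
    have h1 : (#{y ∈ B₁ | l * a * y ∈ B} : ℝ) ≤ 1 := by
      exact_mod_cast (card_filter_le _ _).trans hone
    have h2 : (#A : ℝ) / (768 * M ^ 2) ≤ 1 := hθ.trans ((hdeg a ha).trans h1)
    rw [div_le_one (by positivity)] at h2
    exact hfin 768 2 (by norm_num) (by norm_num) h2
  push Not at hone
  obtain ⟨b₀, hb₀, b₁, hb₁, hb01⟩ := one_lt_card.1 hone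
  set D : ℝ := 10 ^ 7 * M ^ 4 with hD
  have hD0 : 0 < D := by positivity
  set Y : F → Finset F := fun a ↦ {y ∈ B₁ | l * a * y ∈ B} with hY
  have hYB₁ : ∀ a, Y a ⊆ B₁ := fun a ↦ filter_subset _ _
  have hYB : ∀ a, Y a ⊆ B := fun a ↦ (hYB₁ a).trans hB₁B
  have hYmem : ∀ a, ∀ y ∈ Y a, l * a * y ∈ B := fun a y hy ↦ (mem_filter.1 hy).2
  -- a half of `Y a` on which the dilation by `l e` is also controlled
  have hhalf : ∀ a ∈ B₁, ∀ e ∈ B₁, ∃ U ⊆ Y a, ∃ Δ : Finset F, θ / 2 ≤ #U ∧ (#Δ : ℝ) ≤ D ∧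
      ∀ y ∈ U, l * e * y ∈ Δ + B := by
    intro a ha e he
    obtain ⟨U, hU, Δ, h1, h2, h3⟩ := hcov e he (Y a) (hYB a)
    exact ⟨U, hU, Δ, by linarith [hdeg a ha], h2, h3⟩
  -- the sum of two large sets with a dilate by a quotient of differences is small
  have hquot : ∀ r ∈ quotSet B₁, ∃ U ⊆ B₁, ∃ V ⊆ B₁, θ / 2 ≤ #U ∧ θ / 2 ≤ #V ∧
      (#(U + V.image (r * ·)) : ℝ) ≤ D ^ 2 * (2 ^ 69 * M ^ 15 * #A) := by
    rintro r ⟨a, ha, e, he, c, hc, d, hd, hcd, rfl⟩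
    obtain ⟨U, hU, Δ₁, hUc, hΔ₁, hU2⟩ := hhalf c hc d hd
    obtain ⟨V, hV, Δ₃, hVc, hΔ₃, hV2⟩ := hhalf a ha e he
    refine ⟨U, hU.trans (hYB₁ c), V, hV.trans (hYB₁ a), hUc, hVc, ?_⟩
    have h := card_dilate_sum_le (U := U) (Y := V) (B := B) (Δ₁ := Δ₁) (Δ₂ := {0}) (Δ₃ := Δ₃)
      (s := 1) (a := a) (e := e) hl hcd (fun u hu ↦ hYmem c u (hU hu)) hU2
      (fun y hy ↦ mem_add.2 ⟨0, mem_singleton_self 0, _, hYmem a y (hV hy), by simp⟩) (fun y hy ↦ by simpa using hV2 y hy)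
    rw [one_mul] at h
    have h' : (#(U + V.image ((a - e) / (c - d) * ·)) : ℝ) ≤ #Δ₁ * 1 * #Δ₃ * #(2 • B - 2 • B) := by
      exact_mod_cast h
    calc _ ≤ (#Δ₁ : ℝ) * 1 * #Δ₃ * #(2 • B - 2 • B) := h'
      _ ≤ D * 1 * D * (2 ^ 69 * M ^ 15 * #A) := by gcongr
      _ = _ := by ring
  by_cases hsubone : ∀ r ∈ quotSet B₁, r - 1 ∈ quotSet B₁
  swap
  · left
    push Not at hsubone
    obtain ⟨r, hr, hr1⟩ := hsubone
    obtain ⟨U, hU, V, hV, hUc, hVc, hUV⟩ := hquot r hr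
    have hU0 : (0 : ℝ) < #U := by linarith
    have hUn : U.Nonempty := card_pos.1 (by exact_mod_cast hU0)
    -- Plünnecke bounds X - V + rV. This contains X + (r - 1)V, which is direct since r - 1 is not a
    -- quotient. The exponent is 32 = 6 + 3 + 8 + 15, from θ³, |B - B|, D² and |2B - 2B|.
    obtain ⟨X, hXU, hXn, hX⟩ := exists_subset_card_add_add_le hUn (-V) (V.image (r * ·))
    have hX0 : (0 : ℝ) < #X := by exact_mod_cast hXn.card_pos
    have hXV : #X * #V ≤ #(X + -V + V.image (r * ·)) := by
      rw [← card_add_image_of_notMem_quotSet hr1 (hXU.trans hU) hV]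
      refine card_le_card fun z hz ↦ ?_
      obtain ⟨x, hx, w, hw, rfl⟩ := mem_add.1 hz
      obtain ⟨y, hy, rfl⟩ := mem_image.1 hw
      refine mem_add.2 ⟨x + -y, add_mem_add hx (neg_mem_neg hy), r * y, mem_image_of_mem _ hy, ?_⟩
      ring
    have hUV' : #(U + -V) ≤ #(B - B) := by
      rw [← sub_eq_add_neg]
      exact card_le_card (sub_subset_sub (hU.trans hB₁B) (hV.trans hB₁B))
    have h1 : (#V * #U ^ 2) * #X ≤ (4 * #(B - B) * #(U + V.image (r * ·))) * #X := by
      calc (#V * #U ^ 2) * #X = (#X * #V) * #U ^ 2 := by ring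
        _ ≤ #(X + -V + V.image (r * ·)) * #U ^ 2 := Nat.mul_le_mul_right _ hXV
        _ ≤ 4 * #(U + -V) * #(U + V.image (r * ·)) * #X := hX
        _ ≤ _ := by gcongr
    have h2 : (#V : ℝ) * (#U : ℝ) ^ 2 ≤ 4 * #(B - B) * #(U + V.image (r * ·)) := by
      exact_mod_cast Nat.le_of_mul_le_mul_right h1 hXn.card_pos
    have h3 : (#A : ℝ) ^ 3 ≤ (2 ^ 165 * M ^ 32) * (#A : ℝ) ^ 2 := by
      calc (#A : ℝ) ^ 3 = (1536 * M ^ 2) ^ 3 * ((#A : ℝ) / (768 * M ^ 2) / 2) ^ 3 := by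
            field_simp; norm_num
        _ ≤ (1536 * M ^ 2) ^ 3 * (θ / 2) ^ 3 := by gcongr
        _ = (1536 * M ^ 2) ^ 3 * ((θ / 2) * (θ / 2) ^ 2) := by ring
        _ ≤ (1536 * M ^ 2) ^ 3 * (#V * (#U : ℝ) ^ 2) := by gcongr
        _ ≤ (1536 * M ^ 2) ^ 3 * (4 * #(B - B) * #(U + V.image (r * ·))) := by gcongr
        _ ≤ (1536 * M ^ 2) ^ 3 * (4 * (2 ^ 15 * M ^ 3 * #A) * (D ^ 2 * (2 ^ 69 * M ^ 15 * #A))) := by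
            gcongr
        _ = (1536 ^ 3 * 4 * 2 ^ 15 * 10 ^ 14 * 2 ^ 69) * (M ^ 32 * (#A : ℝ) ^ 2) := by
            rw [hD]; ring
        _ ≤ 2 ^ 165 * (M ^ 32 * (#A : ℝ) ^ 2) := by gcongr; norm_num
        _ = _ := by ring
    have h4 : (#A : ℝ) ≤ 2 ^ 165 * M ^ 32 := by
      have h5 : (#A : ℝ) * (#A : ℝ) ^ 2 ≤ (2 ^ 165 * M ^ 32) * (#A : ℝ) ^ 2 := by linarith
      exact le_of_mul_le_mul_right h5 (by positivity)
    exact hfin _ 32 le_rfl le_rfl h4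
  by_cases hmulx : ∀ x ∈ B₁, ∀ r ∈ quotSet B₁, l * x * r ∈ quotSet B₁
  swap
  · left
    push Not at hmulx
    -- The sum U + (l x r)V is direct, yet small by `card_dilate_sum_le` with s = l x. Here l a also
    -- requires a covering, so D appears cubed and the exponent is 31 = 4 + 12 + 15.
    obtain ⟨x, hx, r, ⟨a, ha, e, he, c, hc, d, hd, hcd, rfl⟩, hxr⟩ := hmulx
    obtain ⟨U, hU, Δ₁, hUc, hΔ₁, hU2⟩ := hhalf c hc d hd
    have hlx : l * x ≠ 0 := mul_ne_zero hl (hB0 x (hB₁B hx))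
    -- pull back along multiplication by `l x`
    have hpull : ∀ f ∈ B₁, ∀ W ⊆ Y x, ∃ W' ⊆ W, ∃ Δ : Finset F, (#W : ℝ) / 2 ≤ #W' ∧ (#Δ : ℝ) ≤ D ∧
        ∀ y ∈ W', l * f * (l * x * y) ∈ Δ + B := by
      intro f hf W hW
      obtain ⟨W', hW', Δ, h1, h2, h3⟩ := hcov f hf (W.image (l * x * ·)) (by
        intro z hz
        obtain ⟨w, hw, rfl⟩ := mem_image.1 hz
        exact hYmem x w (hW hw))
      rw [card_image_of_injective _ (mul_right_injective₀ hlx)] at h1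
      refine ⟨{w ∈ W | l * x * w ∈ W'}, filter_subset _ _, Δ, h1.trans ?_, h2,
        fun y hy ↦ h3 _ (mem_filter.1 hy).2⟩
      norm_cast
      refine le_trans (card_le_card ?_) (card_image_le (f := (l * x * ·)))
      intro z hz
      obtain ⟨w, hw, rfl⟩ := mem_image.1 (hW' hz)
      exact mem_image_of_mem _ (mem_filter.2 ⟨hw, hz⟩)
    -- Dilations by l a and l e are controlled one after the other; the two halvings leave θ / 4.
    obtain ⟨V₁, hV₁, Δ₂, hV₁c, hΔ₂, hV₁m⟩ := hpull a ha (Y x) subset_rfl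
    obtain ⟨V, hV, Δ₃, hVc, hΔ₃, hVm⟩ := hpull e he V₁ hV₁
    have hVθ : θ / 4 ≤ #V := by linarith [hdeg x hx]
    have h := card_dilate_sum_le (U := U) (Y := V) (B := B) (s := l * x) hl hcd
      (fun u hu ↦ hYmem c u (hU hu)) hU2 (fun y hy ↦ hV₁m y (hV hy)) hVm
    rw [card_add_image_of_notMem_quotSet hxr (hU.trans (hYB₁ c)) (hV.trans (hV₁.trans (hYB₁ x)))] at h
    have h' : (#U : ℝ) * #V ≤ #Δ₁ * #Δ₂ * #Δ₃ * #(2 • B - 2 • B) := by exact_mod_cast h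
    have h3 : (#A : ℝ) ^ 2 ≤ (2 ^ 165 * M ^ 31) * (#A : ℝ) := by
      calc (#A : ℝ) ^ 2 = (768 * M ^ 2) ^ 2 * 8 *
            (((#A : ℝ) / (768 * M ^ 2) / 2) * ((#A : ℝ) / (768 * M ^ 2) / 4)) := by
            field_simp; norm_num
        _ ≤ (768 * M ^ 2) ^ 2 * 8 * (θ / 2 * (θ / 4)) := by gcongr
        _ ≤ (768 * M ^ 2) ^ 2 * 8 * (#U * #V) := by gcongr
        _ ≤ (768 * M ^ 2) ^ 2 * 8 * (#Δ₁ * #Δ₂ * #Δ₃ * #(2 • B - 2 • B)) := by gcongr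
        _ ≤ (768 * M ^ 2) ^ 2 * 8 * (D * D * D * (2 ^ 69 * M ^ 15 * #A)) := by gcongr
        _ = (768 ^ 2 * 8 * 10 ^ 21 * 2 ^ 69) * (M ^ 31 * (#A : ℝ)) := by rw [hD]; ring
        _ ≤ 2 ^ 165 * (M ^ 31 * (#A : ℝ)) := by gcongr; norm_num
        _ = _ := by ring
    have h4 : (#A : ℝ) ≤ 2 ^ 165 * M ^ 31 := by
      rw [sq] at h3
      exact le_of_mul_le_mul_right h3 hK
    exact hfin _ 31 le_rfl (by norm_num) h4
  obtain ⟨L, hTL, hLQ⟩ := exists_subfield_of_closed ((l * ·) '' (B₁ : Set F)) (quotSet B₁)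
    ⟨b₀, hb₀, b₀, hb₀, b₀, hb₀, b₁, hb₁, hb01, by simp⟩
    (by
      rintro r ⟨a, ha, e, he, c, hc, d, hd, hcd, rfl⟩
      exact ⟨e, he, a, ha, c, hc, d, hd, hcd, by rw [← neg_div, neg_sub]⟩)
    hsubone
    (by
      rintro _ ⟨x, hx, rfl⟩ r hr
      exact hmulx x hx r hr)
  -- As L lies in the quotient set, the upper bound for U + ξV applies to this ξ, while its small
  -- energy forces the sum to be large by Cauchy–Schwarz.
  obtain ⟨ξ, hξL, hξ0, hξE⟩ := exists_dilate_small_energy L B₁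
  obtain ⟨U, hU, V, hV, hUc, hVc, hUV⟩ := hquot ξ (hLQ hξL)
  set E : ℝ := (#B₁ : ℝ) ^ 2 + (#B₁ : ℝ) ^ 4 / ((Nat.card L : ℝ) - 1) with hEdef
  have hen : (#U : ℝ) ^ 2 * (#V : ℝ) ^ 2 ≤ #(U + V.image (ξ * ·)) * E := by
    have h1 := le_card_add_mul_addEnergy U (V.image (ξ * ·))
    rw [card_image_of_injective _ (mul_right_injective₀ hξ0)] at h1
    have h2 : U.addEnergy (V.image (ξ * ·)) ≤ B₁.addEnergy (B₁.image (ξ * ·)) :=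
      addEnergy_mono hU (image_subset_image hV)
    have h3 : ((U.addEnergy (V.image (ξ * ·)) : ℕ) : ℝ) ≤ E := le_trans (by exact_mod_cast h2) hξE
    calc (#U : ℝ) ^ 2 * (#V : ℝ) ^ 2
        ≤ #(U + V.image (ξ * ·)) * (U.addEnergy (V.image (ξ * ·)) : ℕ) := by exact_mod_cast h1
      _ ≤ _ := by gcongr
  have hLcard : 1 < Nat.card L := Finite.one_lt_card
  have hLcard' : (2 : ℝ) ≤ Nat.card L := by exact_mod_cast hLcard
  have hE0 : 0 ≤ E := by
    have : 0 < (Nat.card L : ℝ) - 1 := by linarith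
    positivity
  have hmain : (#A : ℝ) ^ 4 ≤ (2 ^ 159 * M ^ 31 * #A) * E := by
    calc (#A : ℝ) ^ 4 = (1536 * M ^ 2) ^ 4 * ((#A : ℝ) / (768 * M ^ 2) / 2) ^ 4 := by
          field_simp; norm_num
      _ ≤ (1536 * M ^ 2) ^ 4 * (θ / 2) ^ 4 := by gcongr
      _ = (1536 * M ^ 2) ^ 4 * ((θ / 2) ^ 2 * (θ / 2) ^ 2) := by ring
      _ ≤ (1536 * M ^ 2) ^ 4 * ((#U : ℝ) ^ 2 * (#V : ℝ) ^ 2) := by gcongr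
      _ ≤ (1536 * M ^ 2) ^ 4 * (#(U + V.image (ξ * ·)) * E) := by gcongr
      _ ≤ (1536 * M ^ 2) ^ 4 * ((D ^ 2 * (2 ^ 69 * M ^ 15 * #A)) * E) := by gcongr
      _ = (1536 ^ 4 * 10 ^ 14 * 2 ^ 69) * (M ^ 31 * #A * E) := by rw [hD]; ring
      _ ≤ 2 ^ 159 * (M ^ 31 * #A * E) := by gcongr; norm_num
      _ = _ := by ring
  have hB₁A : (#B₁ : ℝ) ≤ #A := by exact_mod_cast card_le_card (hB₁B.trans hBA)
  have hEle : E ≤ (#B₁ : ℝ) ^ 2 + 2 * (#B₁ : ℝ) ^ 4 / Nat.card L := by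
    rw [hEdef]
    refine add_le_add le_rfl ?_
    rw [div_le_div_iff₀ (by linarith) (by linarith)]
    have : 0 ≤ (#B₁ : ℝ) ^ 4 := by positivity
    nlinarith
  have hL0 : (0 : ℝ) < Nat.card L := by linarith
  -- if the second term of the energy is dominated by the first one we are done
  have hdone : E ≤ (1 + 2 * C₀ ^ 2 + 2) * (#A : ℝ) ^ 2 →
      (#A : ℝ) ≤ 2 ^ 165 * (1 + 2 * C₀ ^ 2) * M ^ 32 := by
    intro hE'
    have h1 : (#A : ℝ) * (#A : ℝ) ^ 3 ≤
        (2 ^ 159 * M ^ 31 * (1 + 2 * C₀ ^ 2 + 2)) * (#A : ℝ) ^ 3 := by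
      calc (#A : ℝ) * (#A : ℝ) ^ 3 = (#A : ℝ) ^ 4 := by ring
        _ ≤ (2 ^ 159 * M ^ 31 * #A) * E := hmain
        _ ≤ (2 ^ 159 * M ^ 31 * #A) * ((1 + 2 * C₀ ^ 2 + 2) * (#A : ℝ) ^ 2) := by gcongr
        _ = _ := by ring
    have h2 := le_of_mul_le_mul_right h1 (by positivity)
    calc (#A : ℝ) ≤ 2 ^ 159 * M ^ 31 * (1 + 2 * C₀ ^ 2 + 2) := h2
      _ ≤ 2 ^ 159 * M ^ 32 * (3 * (1 + 2 * C₀ ^ 2)) := by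
        have := hM32 31 (by norm_num)
        gcongr
        linarith
      _ = 3 * 2 ^ 159 * (M ^ 32 * (1 + 2 * C₀ ^ 2)) := by ring
      _ ≤ 2 ^ 165 * (M ^ 32 * (1 + 2 * C₀ ^ 2)) := by gcongr; norm_num
      _ = _ := by ring
  by_cases hLtop : L = ⊤
  · have hLF : (Nat.card L : ℝ) = Fintype.card F := by
      rw [hLtop, ← Nat.card_eq_fintype_card]
      exact_mod_cast Nat.card_congr (Equiv.Set.univ F)
    rw [hLF] at hEle hL0
    have hEA : E ≤ (#A : ℝ) ^ 2 + 2 * (#A : ℝ) ^ 4 / Fintype.card F :=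
      hEle.trans (by gcongr)
    -- When |A|² ≤ q the diagonal part of the energy bound is of the dominant order |A|²; otherwise
    -- |A|⁴ / q dominates, which is the source of the second alternative.
    by_cases hq : (#A : ℝ) ^ 2 ≤ Fintype.card F
    · left
      apply hdone
      have h1 : 2 * (#A : ℝ) ^ 4 / Fintype.card F ≤ 2 * (#A : ℝ) ^ 2 := by
        rw [div_le_iff₀ hL0]
        nlinarith [sq_nonneg (#A : ℝ)]
      nlinarith [sq_nonneg C₀, sq_nonneg (#A : ℝ), mul_nonneg (sq_nonneg C₀) (sq_nonneg (#A : ℝ))]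
    · right
      push Not at hq
      have h1 : E ≤ 3 * (#A : ℝ) ^ 4 / Fintype.card F := by
        have h2 : (#A : ℝ) ^ 2 ≤ (#A : ℝ) ^ 4 / Fintype.card F := by
          rw [le_div_iff₀ hL0]
          nlinarith [sq_nonneg (#A : ℝ)]
        have h4 : 3 * (#A : ℝ) ^ 4 / Fintype.card F =
            (#A : ℝ) ^ 4 / Fintype.card F + 2 * (#A : ℝ) ^ 4 / Fintype.card F := by ring
        linarith
      rw [le_div_iff₀ hL0] at h1
      have h2 : (Fintype.card F : ℝ) * (#A : ℝ) ^ 4 ≤ (3 * 2 ^ 159 * M ^ 31 * #A) * (#A : ℝ) ^ 4 := by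
        calc (Fintype.card F : ℝ) * (#A : ℝ) ^ 4
            ≤ Fintype.card F * ((2 ^ 159 * M ^ 31 * #A) * E) := by gcongr
          _ = (2 ^ 159 * M ^ 31 * #A) * (E * Fintype.card F) := by ring
          _ ≤ (2 ^ 159 * M ^ 31 * #A) * (3 * (#A : ℝ) ^ 4) := by gcongr
          _ = _ := by ring
      have h3 := le_of_mul_le_mul_right h2 (by positivity)
      refine h3.trans ?_
      gcongr
      norm_num
  · left
    apply hdone
    have h1 := hsub L hLtop l hl B₁ (hB₁B.trans hBA) fun b hb ↦ hTL ⟨b, hb, rfl⟩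
    have h2 : 2 * (#B₁ : ℝ) ^ 4 / Nat.card L ≤ 2 * C₀ ^ 2 * (#B₁ : ℝ) ^ 2 := by
      rw [div_le_iff₀ hL0]
      nlinarith [sq_nonneg (#B₁ : ℝ)]
    calc E ≤ (1 + 2 * C₀ ^ 2) * (#B₁ : ℝ) ^ 2 := by linarith
      _ ≤ (1 + 2 * C₀ ^ 2 + 2) * (#A : ℝ) ^ 2 := by
        refine mul_le_mul (by linarith) (by gcongr) (by positivity) (by positivity)

end Field

/-! ### Character sums and additive energy -/

section Characters

variable {F : Type*} [Field F] [Fintype F] [DecidableEq F]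

/-- The exponential sum over a finite set `A` attached to an additive character. -/
noncomputable def charSum (χ : AddChar F ℂ) (A : Finset F) (a : F) : ℂ := ∑ x ∈ A, χ (a * x)

theorem charSum_mul_conj (χ : AddChar F ℂ) (A : Finset F) (a : F) :
    charSum χ A a * (starRingEnd ℂ) (charSum χ A a) = ∑ d, (diffRep A d : ℂ) * χ (a * d) := by
  simp only [charSum, map_sum, sum_mul_sum, diffRep, card_filter]
  push_cast
  simp only [sum_mul]
  rw [sum_comm (s := univ)]
  refine sum_congr rfl fun x _ ↦ ?_
  simp only [ite_mul, one_mul, zero_mul]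
  rw [← sum_filter]
  refine sum_bij' (fun y _ ↦ x - y) (fun d _ ↦ x - d) ?_ ?_ ?_ ?_ ?_
  · intro y hy; simpa using hy
  · intro d hd; simpa using hd
  · intro y _; simp
  · intro d _; simp
  · intro y _
    rw [← AddChar.map_neg_eq_conj, ← AddChar.map_add_eq_mul]
    congr 1
    ring

/-- Parseval's identity for a finite field. -/
theorem sum_normSq_fourier {χ : AddChar F ℂ} (hχ : χ.IsPrimitive) (f : F → ℂ) :
    ∑ a, ‖∑ d, f d * χ (a * d)‖ ^ 2 = Fintype.card F * ∑ d, ‖f d‖ ^ 2 := by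
  have key : ∑ a, ((∑ d, f d * χ (a * d)) * (starRingEnd ℂ) (∑ d, f d * χ (a * d)))
      = Fintype.card F * ∑ d, f d * (starRingEnd ℂ) (f d) := by
    simp only [map_sum, map_mul, sum_mul_sum]
    rw [sum_comm, mul_sum]
    refine sum_congr rfl fun d _ ↦ ?_
    rw [sum_comm]
    have : ∀ e, ∑ a, f d * χ (a * d) * ((starRingEnd ℂ) (f e) * (starRingEnd ℂ) (χ (a * e)))
        = f d * (starRingEnd ℂ) (f e) * (if d - e = 0 then (Fintype.card F : ℂ) else 0) := by
      intro e
      have h := AddChar.sum_mulShift (d - e) hχ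
      rw [apply_ite Nat.cast] at h
      push_cast at h
      rw [← h, mul_sum]
      refine sum_congr rfl fun a _ ↦ ?_
      rw [← AddChar.map_neg_eq_conj, mul_sub, sub_eq_add_neg, AddChar.map_add_eq_mul]
      ring
    simp only [this, sub_eq_zero, mul_ite, mul_zero, sum_ite_eq, mem_univ, if_true]
    ring
  simp only [Complex.mul_conj, Complex.normSq_eq_norm_sq] at key
  exact_mod_cast key

theorem norm_charSum_sq (χ : AddChar F ℂ) (A : Finset F) (a : F) :
    ‖charSum χ A a‖ ^ 2 = ‖∑ d, (diffRep A d : ℂ) * χ (a * d)‖ := by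
  rw [← charSum_mul_conj, Complex.mul_conj, Complex.norm_real, Complex.normSq_eq_norm_sq,
    Real.norm_of_nonneg (by positivity)]

/-- The fourth moment of exponential sums is the additive energy. -/
theorem sum_norm_charSum_pow_four {χ : AddChar F ℂ} (hχ : χ.IsPrimitive) (A : Finset F) :
    ∑ a, ‖charSum χ A a‖ ^ 4 = Fintype.card F * (energy A : ℝ) := by
  have h := sum_normSq_fourier hχ fun d ↦ (diffRep A d : ℂ)
  simp only [← norm_charSum_sq, Complex.norm_natCast, ← pow_mul] at h
  rw [h, energy]
  push_cast
  rfl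

/-- The bilinear estimate for exponential sums in terms of additive energies. -/
theorem sum_norm_charSum_pow_eight_le {χ : AddChar F ℂ} (hχ : χ.IsPrimitive) (A H : Finset F) (a : F)
    (ha : a ≠ 0) :
    (∑ h ∈ H, ‖charSum χ A (a * h)‖) ^ 8 ≤
      (#A : ℝ) ^ 4 * (#H : ℝ) ^ 4 * energy H * (Fintype.card F * energy A) := by
  set W := ∑ h ∈ H, ‖charSum χ A (a * h)‖ with hW
  have hW0 : 0 ≤ W := by positivity
  -- unimodular coefficients
  have hθ : ∀ z : ℂ, ∃ θ : ℂ, ‖θ‖ ≤ 1 ∧ (‖z‖ : ℂ) = θ * z := by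
    intro z
    rcases eq_or_ne z 0 with rfl | hz
    · exact ⟨0, by simp, by simp⟩
    · refine ⟨‖z‖ / z, ?_, by field_simp⟩
      rw [norm_div, Complex.norm_real, norm_norm, div_self (norm_ne_zero_iff.2 hz)]
  choose θ hθ1 hθ2 using hθ
  set c : F → ℂ := fun h ↦ θ (charSum χ A (a * h)) with hc
  have hWeq : (W : ℂ) = ∑ x ∈ A, ∑ h ∈ H, c h * χ (a * h * x) := by
    rw [hW, sum_comm]
    push_cast
    refine sum_congr rfl fun h _ ↦ ?_
    rw [hθ2]
    change c h * charSum χ A (a * h) = _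
    rw [charSum, mul_sum]
  have hWle : W ≤ ∑ x ∈ A, ‖∑ h ∈ H, c h * χ (a * h * x)‖ := by
    have : W = ‖(W : ℂ)‖ := by rw [Complex.norm_real, Real.norm_of_nonneg hW0]
    rw [this, hWeq]
    exact norm_sum_le _ _
  -- First Cauchy–Schwarz, over x ∈ A. Opening the square leaves sums at a (h - k), grouped below by
  -- the difference d = h - k.
  have h1 : W ^ 2 ≤ #A * ∑ x ∈ A, ‖∑ h ∈ H, c h * χ (a * h * x)‖ ^ 2 :=
    (pow_le_pow_left₀ hW0 hWle 2).trans sq_sum_le_card_mul_sum_sq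
  have h2 : ∑ x ∈ A, ‖∑ h ∈ H, c h * χ (a * h * x)‖ ^ 2 ≤
      ∑ d, (diffRep H d : ℝ) * ‖charSum χ A (a * d)‖ := by
    have e1 : ((∑ x ∈ A, ‖∑ h ∈ H, c h * χ (a * h * x)‖ ^ 2 : ℝ) : ℂ) =
        ∑ h ∈ H, ∑ k ∈ H, c h * (starRingEnd ℂ) (c k) * charSum χ A (a * (h - k)) := by
      have : ∀ x, ((‖∑ h ∈ H, c h * χ (a * h * x)‖ ^ 2 : ℝ) : ℂ) =
          ∑ h ∈ H, ∑ k ∈ H, c h * (starRingEnd ℂ) (c k) * χ (a * (h - k) * x) := by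
        intro x
        rw [← Complex.normSq_eq_norm_sq, ← Complex.mul_conj, map_sum, sum_mul_sum]
        refine sum_congr rfl fun h _ ↦ sum_congr rfl fun k _ ↦ ?_
        rw [map_mul (starRingEnd ℂ), ← AddChar.map_neg_eq_conj, mul_sub, sub_mul, sub_eq_add_neg,
          AddChar.map_add_eq_mul]
        ring
      rw [Complex.ofReal_sum, sum_congr rfl fun x _ ↦ this x, sum_comm]
      refine sum_congr rfl fun h _ ↦ ?_
      rw [sum_comm]
      refine sum_congr rfl fun k _ ↦ ?_
      rw [charSum, mul_sum]
    have e2 : ∑ x ∈ A, ‖∑ h ∈ H, c h * χ (a * h * x)‖ ^ 2 ≤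
        ∑ h ∈ H, ∑ k ∈ H, ‖charSum χ A (a * (h - k))‖ := by
      have e3 : ∑ x ∈ A, ‖∑ h ∈ H, c h * χ (a * h * x)‖ ^ 2 =
          ‖((∑ x ∈ A, ‖∑ h ∈ H, c h * χ (a * h * x)‖ ^ 2 : ℝ) : ℂ)‖ := by
        rw [Complex.norm_real, Real.norm_of_nonneg (by positivity)]
      rw [e3, e1]
      refine (norm_sum_le _ _).trans (sum_le_sum fun h _ ↦ (norm_sum_le _ _).trans
        (sum_le_sum fun k _ ↦ ?_))
      rw [norm_mul, norm_mul, RCLike.norm_conj]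
      calc ‖c h‖ * ‖c k‖ * ‖charSum χ A (a * (h - k))‖
          ≤ 1 * 1 * ‖charSum χ A (a * (h - k))‖ := by
            gcongr
            · exact hθ1 _
            · exact hθ1 _
        _ = _ := by ring
    refine e2.trans_eq ?_
    simp only [diffRep, card_filter]
    push_cast
    simp only [sum_mul]
    rw [sum_comm (s := univ)]
    refine sum_congr rfl fun x _ ↦ ?_
    simp only [ite_mul, one_mul, zero_mul]
    rw [← sum_filter]
    refine sum_bij' (fun y _ ↦ x - y) (fun d _ ↦ x - d) ?_ ?_ ?_ ?_ ?_
    · intro y hy; simpa using hy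
    · intro d hd; simpa using hd
    · intro y _; simp
    · intro d _; simp
    · intro y _; rfl
  set T := ∑ d, (diffRep H d : ℝ) * ‖charSum χ A (a * d)‖ with hT
  have hT0 : 0 ≤ T := by positivity
  -- Two more applications of Cauchy–Schwarz use the first and second moments of `diffRep H`, namely
  -- |H|² and the energy of H; the remaining factor is the fourth moment of the sums over A.
  have h3 : T ^ 2 ≤ (#H : ℝ) ^ 2 * ∑ d, (diffRep H d : ℝ) * ‖charSum χ A (a * d)‖ ^ 2 := by
    have := sum_sq_le_sum_mul_sum_of_sq_le_mul (univ : Finset F)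
      (r := fun d ↦ (diffRep H d : ℝ) * ‖charSum χ A (a * d)‖) (f := fun d ↦ (diffRep H d : ℝ))
      (g := fun d ↦ (diffRep H d : ℝ) * ‖charSum χ A (a * d)‖ ^ 2)
      (by intros; positivity) (by intros; positivity) (fun d _ ↦ le_of_eq (by ring))
    refine this.trans_eq ?_
    congr 1
    exact_mod_cast sum_diffRep H
  have h4 : (∑ d, (diffRep H d : ℝ) * ‖charSum χ A (a * d)‖ ^ 2) ^ 2 ≤
      energy H * (Fintype.card F * energy A) := by
    refine (sum_mul_sq_le_sq_mul_sq _ _ _).trans_eq ?_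
    congr 1
    · simp [energy]
    · rw [← sum_norm_charSum_pow_four hχ, ←
        Equiv.sum_comp (Equiv.mulLeft₀ a ha) fun d ↦ ‖charSum χ A d‖ ^ 4]
      refine sum_congr rfl fun d _ ↦ ?_
      rw [← pow_mul]
      rfl
  calc W ^ 8 = ((W ^ 2) ^ 2) ^ 2 := by ring
    _ ≤ ((#A * T) ^ 2) ^ 2 := by
      have : W ^ 2 ≤ #A * T := h1.trans (by gcongr)
      gcongr
    _ = (#A : ℝ) ^ 4 * (T ^ 2) ^ 2 := by ring
    _ ≤ (#A : ℝ) ^ 4 * ((#H : ℝ) ^ 2 * ∑ d, (diffRep H d : ℝ) * ‖charSum χ A (a * d)‖ ^ 2) ^ 2 := by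
      gcongr
    _ = (#A : ℝ) ^ 4 * (#H : ℝ) ^ 4 * (∑ d, (diffRep H d : ℝ) * ‖charSum χ A (a * d)‖ ^ 2) ^ 2 := by
      ring
    _ ≤ (#A : ℝ) ^ 4 * (#H : ℝ) ^ 4 * (energy H * (Fintype.card F * energy A)) := by gcongr
    _ = _ := by ring

end Characters

section TraceCharacter

variable (p : ℕ) [Fact p.Prime] (F : Type*) [Field F] [Algebra (ZMod p) F]

/-- The additive character `x ↦ e_p(Tr x)`. -/
noncomputable def traceChar : AddChar F ℂ :=
  (ZMod.stdAddChar (N := p)).compAddMonoidHom (Algebra.trace (ZMod p) F).toAddMonoidHom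

/-- The standard character of `ZMod p` is injective, so if this character were trivial the trace
would vanish identically, against nondegeneracy of the trace form. Over a field nontrivial
characters are primitive. -/
theorem traceChar_isPrimitive [Fintype F] : (traceChar p F).IsPrimitive := by
  refine AddChar.IsPrimitive.of_ne_one fun h ↦ ?_
  have htr := (traceForm_nondegenerate (ZMod p) F).1 1
  refine one_ne_zero (htr fun b ↦ ?_)
  have hb : ZMod.stdAddChar (N := p) (Algebra.trace (ZMod p) F b) = 1 := by
    have := DFunLike.congr_fun h b
    simpa [traceChar] using this
  rw [Algebra.traceForm_apply, one_mul]
  rw [← (ZMod.stdAddChar (N := p)).map_zero_eq_one] at hb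
  exact ZMod.injective_stdAddChar hb

end TraceCharacter

/-! ### The set of powers of g -/

section Powers

variable {F : Type*} [Field F]

theorem pow_injOn_Icc {g : Fˣ} {K : ℕ} (hK : K ≤ orderOf g) :
    Set.InjOn (fun j : ℕ ↦ (g : F) ^ j) (Icc 1 K : Finset ℕ) := by
  intro i hi j hj hij
  simp only [coe_Icc, Set.mem_Icc] at hi hj
  have h1 : g ^ i = g ^ j := Units.ext (by simpa using hij)
  -- K may equal the order of g, so the exponents are moved down by one into the range [0, `orderOf
  -- g`).
  have h2 : g ^ (i - 1) = g ^ (j - 1) := by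
    have h3 : g ^ (i - 1) * g = g ^ (j - 1) * g := by
      rw [← pow_succ, ← pow_succ, Nat.sub_add_cancel hi.1, Nat.sub_add_cancel hj.1, h1]
    exact mul_right_cancel h3
  have h4 := pow_injOn_Iio_orderOf (x := g) (Set.mem_Iio.2 (by omega : i - 1 < orderOf g))
    (Set.mem_Iio.2 (by omega : j - 1 < orderOf g)) h2
  omega

/-- F is a vector space over L, so its cardinality is a power of that of L; equal cardinalities
would make L everything. This matches proper subfields with the exponents ν in the gcd hypothesis.
-/
theorem exists_card_subfield_eq_pow [Fintype F] {p m : ℕ} [Fact p.Prime] [Algebra (ZMod p) F]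
    (hF : Fintype.card F = p ^ m) {L : Subfield F} (hL : L ≠ ⊤) :
    ∃ ν : ℕ, 1 ≤ ν ∧ ν < m ∧ ν ∣ m ∧ Nat.card L = p ^ ν := by
  have hp : p.Prime := Fact.out
  have : CharP F p := charP_of_injective_algebraMap (algebraMap (ZMod p) F).injective p
  have : CharP L p := RingHom.charP L.subtype L.subtype.injective p
  have : Fintype L := Fintype.ofFinite L
  obtain ⟨n, -, hn⟩ := FiniteField.card L p
  have hFL : Fintype.card F = Fintype.card L ^ Module.finrank L F := Module.card_eq_pow_finrank
  set k := Module.finrank L F with hk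
  have hk0 : 0 < k := Module.finrank_pos
  have hm : m = n * k := by
    rw [hF, hn, ← pow_mul] at hFL
    exact Nat.pow_right_injective hp.two_le hFL
  refine ⟨n, n.pos, ?_, ⟨k, hm⟩, by rw [Nat.card_eq_fintype_card, hn]⟩
  rcases Nat.lt_or_ge (n : ℕ) m with h | h
  · exact h
  · exfalso
    have hk1 : k = 1 := by
      have h1 : (n : ℕ) * k ≤ n * 1 := by omega
      have := Nat.le_of_mul_le_mul_left h1 n.pos
      omega
    rw [hk1, pow_one] at hFL
    apply hL
    have hsurj : Function.Bijective L.subtype :=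
      (Fintype.bijective_iff_injective_and_card _).2 ⟨L.subtype.injective, hFL.symm⟩
    rw [eq_top_iff]
    intro x _
    obtain ⟨y, rfl⟩ := hsurj.2 x
    exact y.2

variable [DecidableEq F]

/-- The set of the first `K` powers of `g`. -/
def powSet (g : Fˣ) (K : ℕ) : Finset F := (Icc 1 K).image fun j ↦ (g : F) ^ j

theorem card_powSet {g : Fˣ} {K : ℕ} (hK : K ≤ orderOf g) : #(powSet g K) = K := by
  rw [powSet, card_image_of_injOn (pow_injOn_Icc hK), Nat.card_Icc]
  simp

theorem powSet_mono (g : Fˣ) {H K : ℕ} (h : H ≤ K) : powSet g H ⊆ powSet g K :=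
  image_subset_image (Icc_subset_Icc le_rfl h)

theorem zero_notMem_powSet (g : Fˣ) (K : ℕ) : (0 : F) ∉ powSet g K := by
  intro h
  obtain ⟨j, -, hj⟩ := mem_image.1 h
  exact pow_ne_zero j g.ne_zero hj

/-- The exponents i - j - k all lie in an interval of at most 3K integers. -/
theorem card_powSet_div_le {g : Fˣ} {K : ℕ} (hK : K ≤ orderOf g) :
    #((powSet g K ×ˢ powSet g K ×ˢ powSet g K).image fun x ↦ x.1 / (x.2.1 * x.2.2)) ≤
      3 * #(powSet g K) := by
  rw [card_powSet hK]
  have hsub : (powSet g K ×ˢ powSet g K ×ˢ powSet g K).image (fun x ↦ x.1 / (x.2.1 * x.2.2)) ⊆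
      (Icc (1 - 2 * K : ℤ) (K - 1)).image fun i ↦ (g : F) ^ i := by
    intro z hz
    obtain ⟨⟨x, y, w⟩, h, rfl⟩ := mem_image.1 hz
    simp only [powSet, mem_product, mem_image, mem_Icc] at h
    obtain ⟨⟨i, hi, rfl⟩, ⟨j, hj, rfl⟩, k, hk, rfl⟩ := h
    refine mem_image.2 ⟨(i : ℤ) - (j + k), mem_Icc.2 (by omega), ?_⟩
    simp only
    rw [zpow_sub₀ g.ne_zero, zpow_add₀ g.ne_zero, zpow_natCast, zpow_natCast, zpow_natCast]
  refine (card_le_card hsub).trans (card_image_le.trans ?_)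
  rw [Int.card_Icc]
  omega

/-- A subset of the powers of `g` contained in a dilate of a subfield is small if `g` generates a
group which has small intersection with the multiplicative group of the subfield. -/
theorem card_le_gcd_of_dilate_mem_subfield [Fintype F] {g : Fˣ} {K : ℕ} {L : Subfield F} {l : F}
    (hl : l ≠ 0) {B : Finset F} (hB : B ⊆ powSet g K) (hBL : ∀ b ∈ B, l * b ∈ L) :
    #B ≤ Nat.gcd (orderOf g) (Nat.card L - 1) := by
  rcases B.eq_empty_or_nonempty with rfl | ⟨b₀, hb₀⟩
  · simp
  have hd : 0 < Nat.gcd (orderOf g) (Nat.card L - 1) := Nat.gcd_pos_of_pos_left _ (orderOf_pos g)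
  have hpow : ∀ b ∈ B, ∃ u : Fˣ, (u : F) = b ∧ u ∈ Subgroup.zpowers g := by
    intro b hb
    obtain ⟨j, -, rfl⟩ := mem_image.1 (hB hb)
    exact ⟨g ^ j, by simp, Subgroup.npow_mem_zpowers g j⟩
  have : Fintype L := Fintype.ofFinite L
  have h0 : ∀ b ∈ B, b ≠ 0 := fun b hb h ↦ zero_notMem_powSet g K (h ▸ hB hb)
  -- Dividing by b₀ removes l: the ratios lie both in the group generated by g and in L, hence are
  -- roots of unity of order dividing the gcd.
  have hsub : B.image (· / b₀) ⊆
      (Polynomial.nthRoots (Nat.gcd (orderOf g) (Nat.card L - 1)) (1 : F)).toFinset := by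
    intro z hz
    obtain ⟨b, hb, rfl⟩ := mem_image.1 hz
    rw [Multiset.mem_toFinset, Polynomial.mem_nthRoots hd]
    obtain ⟨u, rfl, hu⟩ := hpow b hb
    obtain ⟨v, rfl, hv⟩ := hpow b₀ hb₀
    have hL : (u : F) / v ∈ L := by
      have := L.div_mem (hBL _ hb) (hBL _ hb₀)
      rwa [mul_div_mul_left _ _ hl] at this
    have h1 : (u / v) ^ orderOf g = 1 := by
      obtain ⟨k, hk⟩ := Subgroup.mem_zpowers_iff.1 (Subgroup.div_mem _ hu hv)
      rw [← hk, ← zpow_natCast, zpow_comm, zpow_natCast, pow_orderOf_eq_one, one_zpow]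
    have h2 : (u / v) ^ (Nat.card L - 1) = 1 := by
      have hne : (⟨(u : F) / v, hL⟩ : L) ≠ 0 := by
        intro h
        have := congrArg Subtype.val h
        exact div_ne_zero u.ne_zero v.ne_zero this
      have := FiniteField.pow_card_sub_one_eq_one (K := L) _ hne
      rw [← Nat.card_eq_fintype_card] at this
      have := congrArg Subtype.val this
      refine Units.ext ?_
      simpa using this
    have h3 : (u / v) ^ Nat.gcd (orderOf g) (Nat.card L - 1) = 1 := pow_gcd_eq_one.2 ⟨h1, h2⟩
    have := congrArg Units.val h3
    simpa using this
  have hcard : #(B.image (· / b₀)) = #B := by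
    refine card_image_of_injective _ fun x y h ↦ ?_
    exact (div_left_inj' (h0 b₀ hb₀)).1 h
  rw [← hcard]
  exact (card_le_card hsub).trans
    ((Multiset.toFinset_card_le _).trans (Polynomial.card_nthRoots _ _))

end Powers

/-- With M = K³ / E, each alternative bounds x = K or x = q / K by c M^k with k ≤ 33, hence by (c
M)^33 because c, M ≥ 1. Taking the 33rd root gives E x^(1/33) ≤ c K³, which is one of the two terms
of the bound. -/
theorem energy_le_of_dichotomy {K q E c : ℝ} (hK : 1 ≤ K) (hq : 1 ≤ q) (hc : 1 ≤ c) (hE : 0 < E)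
    (hEK : E ≤ K ^ 3)
    (h : K ≤ c * (K ^ 3 / E) ^ 32 ∨ q ≤ c * (K ^ 3 / E) ^ 31 * K) :
    E ≤ c * (K ^ (3 - 1 / 33 : ℝ) + q ^ (-(1 / 33) : ℝ) * K ^ (3 + 1 / 33 : ℝ)) := by
  have hK0 : 0 < K := by linarith
  have hq0 : 0 < q := by linarith
  have hc0 : 0 < c := by linarith
  set M := K ^ 3 / E with hM
  have hM1 : 1 ≤ M := by rw [hM, one_le_div hE]; exact hEK
  have hMk : ∀ k ≤ 33, c * M ^ k ≤ (c * M) ^ 33 := by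
    intro k hk
    rw [mul_pow]
    have h1 : c ≤ c ^ 33 := le_self_pow₀ hc (by norm_num)
    have h2 : M ^ k ≤ M ^ 33 := pow_le_pow_right₀ hM1 hk
    gcongr
  have hroot : ∀ x : ℝ, 0 < x → x ≤ (c * M) ^ 33 → E * x ^ (1 / 33 : ℝ) ≤ c * K ^ 3 := by
    intro x hx hxM
    have h1 : x ^ (1 / 33 : ℝ) ≤ c * M := by
      have h2 : x ^ (1 / 33 : ℝ) ≤ ((c * M) ^ 33) ^ (1 / 33 : ℝ) := by gcongr
      refine h2.trans_eq ?_
      rw [← Real.rpow_natCast, ← Real.rpow_mul (by positivity)]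
      norm_num
    calc E * x ^ (1 / 33 : ℝ) ≤ E * (c * M) := by gcongr
      _ = c * K ^ 3 := by rw [hM]; field_simp
  have hK3 : K ^ 3 = K ^ (3 : ℝ) := by norm_cast
  rcases h with h | h
  · have h1 := hroot K hK0 (h.trans (hMk 32 (by norm_num)))
    have h2 : E ≤ c * K ^ (3 - 1 / 33 : ℝ) := by
      rw [Real.rpow_sub hK0, ← hK3, ← mul_div_assoc, le_div_iff₀ (by positivity)]
      exact h1
    have h3 : 0 ≤ q ^ (-(1 / 33) : ℝ) * K ^ (3 + 1 / 33 : ℝ) := by positivity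
    nlinarith
  · have h1 := hroot (q / K) (by positivity) (by
      rw [div_le_iff₀ hK0]
      exact h.trans (by have := hMk 31 (by norm_num); gcongr))
    have h2 : E ≤ c * (q ^ (-(1 / 33) : ℝ) * K ^ (3 + 1 / 33 : ℝ)) := by
      rw [Real.div_rpow hq0.le hK0.le, ← mul_div_assoc, div_le_iff₀ (by positivity)] at h1
      rw [Real.rpow_neg hq0.le, Real.rpow_add hK0, ← hK3]
      have h3 : 0 < q ^ (1 / 33 : ℝ) := by positivity
      calc E = E * q ^ (1 / 33 : ℝ) / q ^ (1 / 33 : ℝ) := by field_simp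
        _ ≤ c * K ^ 3 * K ^ (1 / 33 : ℝ) / q ^ (1 / 33 : ℝ) := by gcongr
        _ = _ := by field_simp
    have h3 : 0 ≤ K ^ (3 - 1 / 33 : ℝ) := by positivity
    nlinarith

/-- The additive energy of the first `K` powers of `g`. -/
theorem energy_powSet_le {C₀ : ℝ} {p m : ℕ} [Fact p.Prime] {F : Type*} [Field F]
    [Fintype F] [DecidableEq F] [Algebra (ZMod p) F] (hF : Fintype.card F = p ^ m) (g : Fˣ)
    (hg : ∀ ν : ℕ, 1 ≤ ν → ν < m → ν ∣ m →
      (Nat.gcd (orderOf g) (p ^ ν - 1) : ℝ) ≤ C₀ * (p : ℝ) ^ ((ν : ℝ) / 2))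
    {K : ℕ} (hK1 : 1 ≤ K) (hK : K ≤ orderOf g) :
    (energy (powSet g K) : ℝ) ≤ 2 ^ 165 * (1 + 2 * C₀ ^ 2) *
      ((K : ℝ) ^ (3 - 1 / 33 : ℝ) +
        (Fintype.card F : ℝ) ^ (-(1 / 33) : ℝ) * (K : ℝ) ^ (3 + 1 / 33 : ℝ)) := by
  set A := powSet g K with hA
  have hAc : #A = K := card_powSet hK
  have hAn : A.Nonempty := card_pos.1 (by omega)
  have hK1' : (1 : ℝ) ≤ K := by exact_mod_cast hK1
  have hE1 : (energy A : ℝ) ≤ (K : ℝ) ^ 3 := by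
    have := energy_le A
    rw [hAc] at this
    exact_mod_cast this
  have hE0 : 0 < energy A := by
    refine sum_pos' (fun _ _ ↦ Nat.zero_le _) ⟨0, mem_univ _, ?_⟩
    have : diffRep A 0 = K := by simp [diffRep, hAc]
    rw [this]
    positivity
  have hE0' : (0 : ℝ) < energy A := by exact_mod_cast hE0
  have hcard : (1 : ℝ) ≤ Fintype.card F := by exact_mod_cast Fintype.card_pos
  have hsub : ∀ L : Subfield F, L ≠ ⊤ → ∀ l : F, l ≠ 0 → ∀ B ⊆ A, (∀ b ∈ B, l * b ∈ L) →
      (#B : ℝ) ^ 2 ≤ C₀ ^ 2 * Nat.card L := by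
    intro L hL l hl B hB hBL
    obtain ⟨ν, hν1, hνm, hνd, hLc⟩ := exists_card_subfield_eq_pow (p := p) hF hL
    have h1 := card_le_gcd_of_dilate_mem_subfield hl hB hBL
    rw [hLc] at h1
    have h2 : (#B : ℝ) ≤ C₀ * (p : ℝ) ^ ((ν : ℝ) / 2) :=
      le_trans (by exact_mod_cast h1) (hg ν hν1 hνm hνd)
    calc (#B : ℝ) ^ 2 ≤ (C₀ * (p : ℝ) ^ ((ν : ℝ) / 2)) ^ 2 := by gcongr
      _ = C₀ ^ 2 * Nat.card L := by
        rw [mul_pow, ← Real.rpow_natCast ((p : ℝ) ^ ((ν : ℝ) / 2)), ← Real.rpow_mul (by positivity),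
          hLc]
        norm_num
  -- M is chosen so that the energy hypothesis holds with equality.
  have hdich := card_le_of_energy (zero_notMem_powSet g K) hAn (card_powSet_div_le hK) hsub
    (M := (K : ℝ) ^ 3 / energy A) ((one_le_div hE0').2 hE1)
    (by rw [hAc, div_mul_cancel₀ _ hE0'.ne'])
  rw [hAc] at hdich
  have hc : 1 ≤ 1 + 2 * C₀ ^ 2 := by nlinarith [sq_nonneg C₀]
  refine energy_le_of_dichotomy hK1' hcard (by linarith) hE0' hE1 (hdich.imp id fun h ↦ ?_)
  refine h.trans ?_
  have : (2 : ℝ) ^ 161 ≤ 2 ^ 165 * (1 + 2 * C₀ ^ 2) := by linarith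
  gcongr

/-! ### Shifting incomplete sums -/

section PowerSums

variable {F : Type*} [Field F]

/-- The sum of an additive character over the dilate by `a` of the first `K` powers of `g`. -/
noncomputable def powSum (χ : AddChar F ℂ) (g : Fˣ) (K : ℕ) (a : F) : ℂ :=
  ∑ j ∈ Icc 1 K, χ (a * (g : F) ^ j)

theorem incSum_eq_powSum (p : ℕ) [Fact p.Prime] [Algebra (ZMod p) F] (g : Fˣ) (K : ℕ) (a : F) :
    incSum p g K a = powSum (traceChar p F) g K a := rfl

theorem powSum_eq_charSum [DecidableEq F] (χ : AddChar F ℂ) {g : Fˣ} {K : ℕ} (hK : K ≤ orderOf g)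
    (a : F) : powSum χ g K a = charSum χ (powSet g K) a := by
  rw [charSum, powSet, sum_image (pow_injOn_Icc hK), powSum]

theorem powSum_add (χ : AddChar F ℂ) (g : Fˣ) (H K : ℕ) (a : F) :
    powSum χ g (H + K) a = powSum χ g H a + powSum χ g K (a * (g : F) ^ H) := by
  induction K with
  | zero => simp [powSum]
  | succ K ih =>
    have h : ∀ (b : F) (n : ℕ), powSum χ g (n + 1) b = powSum χ g n b + χ (b * (g : F) ^ (n + 1)) := by
      intro b n
      rw [powSum, sum_Icc_succ_top (by omega), powSum]
    rw [← add_assoc, h, h, ih, mul_assoc a, ← pow_add, add_assoc, add_assoc]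

theorem norm_powSum_le [Finite F] (χ : AddChar F ℂ) (g : Fˣ) (K : ℕ) (a : F) :
    ‖powSum χ g K a‖ ≤ K := by
  refine (norm_sum_le _ _).trans ?_
  simp only [AddChar.norm_apply, sum_const, Nat.card_Icc, nsmul_eq_mul, mul_one]
  simp

/-- A logarithm-free completion argument: to bound the power sums it is enough to bound a quantity
which is dominated by many shifts of the sum. -/
theorem norm_powSum_le_of_shift [Finite F] (χ : AddChar F ℂ) (g : Fˣ) (t : ℕ) {f : ℕ → ℝ}
    (hf0 : 0 ≤ f 0) (hf1 : ∀ K, 1 ≤ K → 1 ≤ f K) (hmono : Monotone f)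
    (hscale : ∀ K, f (K / 64) ≤ f K / 4) {C : ℝ} (hC : 64 ≤ C)
    (hshift : ∀ K, 64 ≤ K → K ≤ t → ∀ a : F, a ≠ 0 → ∀ X : ℝ, 0 ≤ X →
      (∀ h ∈ Icc 1 (K / 64), X ≤ ‖powSum χ g K (a * (g : F) ^ h)‖) → X ≤ C / 2 * f K) :
    ∀ K ≤ t, ∀ a : F, a ≠ 0 → ‖powSum χ g K a‖ ≤ C * f K := by
  intro K
  induction K using Nat.strong_induction_on with
  | _ K ih =>
    intro hK a ha
    rcases Nat.lt_or_ge K 64 with hsmall | hlarge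
    · refine (norm_powSum_le χ g K a).trans ?_
      rcases Nat.eq_zero_or_pos K with rfl | hpos
      · simp only [Nat.cast_zero]
        exact mul_nonneg (by linarith) hf0
      · have h1 := hf1 K hpos
        have h2 : (K : ℝ) ≤ 64 := by exact_mod_cast hsmall.le
        nlinarith
    · have hfK : 0 ≤ f K := zero_le_one.trans (hf1 K (by omega))
      rcases le_or_gt ‖powSum χ g K a‖ (C / 2 * f K) with hle | hgt
      · exact hle.trans (by nlinarith)
      -- Shifting by h ≤ K / 64 changes the sum by two sums of length h. By induction each is at
      -- most C f(K / 64) ≤ (C / 4) f(K), so every shifted sum keeps at least the norm minus (C / 2)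
      -- f(K).
      have hX := hshift K hlarge hK a ha (‖powSum χ g K a‖ - C / 2 * f K) (by linarith) (by
        intro h hh
        rw [mem_Icc] at hh
        have hb : ∀ b : F, b ≠ 0 → ‖powSum χ g h b‖ ≤ C / 4 * f K := by
          intro b hb
          refine (ih h (by omega) (by omega) b hb).trans ?_
          have h1 : f h ≤ f K / 4 := (hmono hh.2).trans (hscale K)
          calc C * f h ≤ C * (f K / 4) := by gcongr
            _ = _ := by ring
        have e : powSum χ g K a = powSum χ g h a + powSum χ g K (a * (g : F) ^ h) -
            powSum χ g h (a * (g : F) ^ K) := by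
          rw [← powSum_add, add_comm h K, powSum_add]
          ring
        have h1 := hb a ha
        have h2 := hb (a * (g : F) ^ K) (mul_ne_zero ha (pow_ne_zero _ g.ne_zero))
        have h3 : ‖powSum χ g K a‖ ≤ ‖powSum χ g h a‖ + ‖powSum χ g K (a * (g : F) ^ h)‖ +
            ‖powSum χ g h (a * (g : F) ^ K)‖ := by
          rw [e]
          exact (norm_sub_le _ _).trans (add_le_add_left (norm_add_le _ _) _)
        linarith)
      linarith

end PowerSums

/-- The relation 64^(1/3) = 4 links the ratio 64 of lengths to the factor 4 needed for the induction
on K. -/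
theorem natDiv_rpow_le {s : ℝ} (hs : 1 / 3 ≤ s) (K : ℕ) :
    ((K / 64 : ℕ) : ℝ) ^ s ≤ (K : ℝ) ^ s / 4 := by
  have h1 : ((K / 64 : ℕ) : ℝ) ≤ (K : ℝ) / 64 := Nat.cast_div_le
  have h2 : (4 : ℝ) ≤ 64 ^ s := by
    calc (4 : ℝ) = 64 ^ (1 / 3 : ℝ) := by
          rw [show (64 : ℝ) = 4 ^ (3 : ℝ) by norm_num, ← Real.rpow_mul (by norm_num)]
          norm_num
      _ ≤ 64 ^ s := Real.rpow_le_rpow_of_exponent_le (by norm_num) hs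
  calc ((K / 64 : ℕ) : ℝ) ^ s ≤ ((K : ℝ) / 64) ^ s := by
        apply Real.rpow_le_rpow (by positivity) h1 (by linarith)
    _ = (K : ℝ) ^ s / 64 ^ s := Real.div_rpow (by positivity) (by norm_num) _
    _ ≤ (K : ℝ) ^ s / 4 := by gcongr

/-- The properties of the bounding functions needed in `norm_powSum_le_of_shift`. -/
theorem two_term_scale {q α β s u : ℝ} (hq : 1 ≤ q) (hα : 0 ≤ α) (hs : 1 / 3 ≤ s) (hu : 1 / 3 ≤ u)
    {f : ℕ → ℝ} (hf : f = fun K : ℕ ↦ q ^ α * (K : ℝ) ^ s + q ^ β * (K : ℝ) ^ u) :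
    0 ≤ f 0 ∧ (∀ K, 1 ≤ K → 1 ≤ f K) ∧ Monotone f ∧ ∀ K, f (K / 64) ≤ f K / 4 := by
  have hq0 : 0 < q := by linarith
  subst hf
  refine ⟨by positivity, fun K hK ↦ ?_, fun H K h ↦ ?_, fun K ↦ ?_⟩
  · have hK' : (1 : ℝ) ≤ K := by exact_mod_cast hK
    have h1 : 1 ≤ q ^ α := Real.one_le_rpow hq hα
    have h2 : 1 ≤ (K : ℝ) ^ s := Real.one_le_rpow hK' (by linarith)
    have h3 : 0 ≤ q ^ β * (K : ℝ) ^ u := by positivity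
    change 1 ≤ q ^ α * (K : ℝ) ^ s + q ^ β * (K : ℝ) ^ u
    nlinarith
  · have h' : (H : ℝ) ≤ K := by exact_mod_cast h
    have : 0 ≤ s := by linarith
    have : 0 ≤ u := by linarith
    change q ^ α * (H : ℝ) ^ s + q ^ β * (H : ℝ) ^ u ≤ q ^ α * (K : ℝ) ^ s + q ^ β * (K : ℝ) ^ u
    gcongr
  · change q ^ α * ((K / 64 : ℕ) : ℝ) ^ s + q ^ β * ((K / 64 : ℕ) : ℝ) ^ u ≤
      (q ^ α * (K : ℝ) ^ s + q ^ β * (K : ℝ) ^ u) / 4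
    have h1 := natDiv_rpow_le hs K
    have h2 := natDiv_rpow_le hu K
    calc _ ≤ q ^ α * ((K : ℝ) ^ s / 4) + q ^ β * ((K : ℝ) ^ u / 4) := by gcongr
      _ = _ := by ring

theorem add_pow_four_le {x y : ℝ} (hx : 0 ≤ x) (hy : 0 ≤ y) : x ^ 4 + y ^ 4 ≤ (x + y) ^ 4 := by
  have h : (x + y) ^ 4 - (x ^ 4 + y ^ 4) = x * y * (4 * x ^ 2 + 6 * (x * y) + 4 * y ^ 2) := by ring
  have : 0 ≤ x * y * (4 * x ^ 2 + 6 * (x * y) + 4 * y ^ 2) := by positivity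
  linarith

theorem term_pow_four {q K : ℝ} (hq : 0 ≤ q) (hK : 0 ≤ K) (α s : ℝ) :
    (q ^ α * K ^ s) ^ 4 = q ^ (α * 4) * K ^ (s * 4) := by
  rw [mul_pow, ← Real.rpow_natCast (q ^ α), ← Real.rpow_natCast (K ^ s), ← Real.rpow_mul hq,
    ← Real.rpow_mul hK]
  norm_num

/-! ### The two pointwise bounds -/

section Bounds

variable {F : Type*} [Field F] [DecidableEq F] {χ : AddChar F ℂ} {g : Fˣ} {c : ℝ}

theorem sum_Icc_dilate_eq (a : F) {H : ℕ} (hH : H ≤ orderOf g) (φ : F → ℝ) :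
    ∑ h ∈ Icc 1 H, φ (a * (g : F) ^ h) = ∑ x ∈ powSet g H, φ (a * x) := by
  rw [powSet, sum_image (pow_injOn_Icc hH)]

variable [Fintype F]

/-- The pointwise bound by the fourth moment. -/
theorem norm_powSum_le_of_fourth_moment (hχ : χ.IsPrimitive) (hc : 1 ≤ c)
    (hE : ∀ K, 1 ≤ K → K ≤ orderOf g → (energy (powSet g K) : ℝ) ≤ c *
      ((K : ℝ) ^ (3 - 1 / 33 : ℝ) +
        (Fintype.card F : ℝ) ^ (-(1 / 33) : ℝ) * (K : ℝ) ^ (3 + 1 / 33 : ℝ)))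
    {K : ℕ} (hK : K ≤ orderOf g) {a : F} (ha : a ≠ 0) :
    ‖powSum χ g K a‖ ≤ 512 * c * ((Fintype.card F : ℝ) ^ (1 / 4 : ℝ) * (K : ℝ) ^ (65 / 132 : ℝ) +
      (Fintype.card F : ℝ) ^ (8 / 33 : ℝ) * (K : ℝ) ^ (67 / 132 : ℝ)) := by
  set q : ℝ := (Fintype.card F : ℝ) with hq
  have hq1 : 1 ≤ q := by rw [hq]; exact_mod_cast Fintype.card_pos
  have hq0 : 0 < q := by linarith
  obtain ⟨h0, h1, h2, h3⟩ := two_term_scale (α := 1 / 4) (β := 8 / 33) (s := 65 / 132)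
    (u := 67 / 132) hq1 (by norm_num) (by norm_num) (by norm_num) rfl
  refine norm_powSum_le_of_shift χ g (orderOf g) h0 h1 h2 h3 (by linarith) ?_ K hK a ha
  intro K hK64 hKt a ha X hX0 hX
  have hK1 : (64 : ℝ) ≤ K := by exact_mod_cast hK64
  have hKpos : (0 : ℝ) < K := by linarith
  have hH : (K : ℝ) ≤ 128 * (K / 64 : ℕ) := by
    have : K ≤ 128 * (K / 64) := by omega
    exact_mod_cast this
  set fK := q ^ (1 / 4 : ℝ) * (K : ℝ) ^ (65 / 132 : ℝ) + q ^ (8 / 33 : ℝ) * (K : ℝ) ^ (67 / 132 : ℝ)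
    with hfK
  have hfK0 : 0 ≤ fK := by positivity
  -- The points a g^h with h ≤ K / 64 are distinct, so the large values at them all contribute to
  -- the complete fourth moment.
  have hsum : (K / 64 : ℕ) * X ^ 4 ≤ q * energy (powSet g K) := by
    rw [hq, ← sum_norm_charSum_pow_four hχ]
    calc ((K / 64 : ℕ) : ℝ) * X ^ 4 = ∑ h ∈ Icc 1 (K / 64), X ^ 4 := by simp
      _ ≤ ∑ h ∈ Icc 1 (K / 64), ‖charSum χ (powSet g K) (a * (g : F) ^ h)‖ ^ 4 := by
        refine sum_le_sum fun h hh ↦ ?_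
        rw [← powSum_eq_charSum χ hKt]
        exact pow_le_pow_left₀ hX0 (hX h hh) 4
      _ = ∑ x ∈ powSet g (K / 64), ‖charSum χ (powSet g K) (a * x)‖ ^ 4 :=
        sum_Icc_dilate_eq a (by omega) fun x ↦ ‖charSum χ (powSet g K) x‖ ^ 4
      _ ≤ ∑ x, ‖charSum χ (powSet g K) (a * x)‖ ^ 4 :=
        sum_le_sum_of_subset_of_nonneg (subset_univ _) (by intros; positivity)
      _ = ∑ x, ‖charSum χ (powSet g K) x‖ ^ 4 :=
        Equiv.sum_comp (Equiv.mulLeft₀ a ha) fun x ↦ ‖charSum χ (powSet g K) x‖ ^ 4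
  -- The exponents in fK are those of (q E / K)^(1/4), applied to the two terms of the energy bound
  -- separately.
  have hf4 : q * ((K : ℝ) ^ (3 - 1 / 33 : ℝ) + q ^ (-(1 / 33) : ℝ) * (K : ℝ) ^ (3 + 1 / 33 : ℝ))
      ≤ K * fK ^ 4 := by
    calc q * ((K : ℝ) ^ (3 - 1 / 33 : ℝ) + q ^ (-(1 / 33) : ℝ) * (K : ℝ) ^ (3 + 1 / 33 : ℝ))
        = K * ((q ^ (1 / 4 : ℝ) * (K : ℝ) ^ (65 / 132 : ℝ)) ^ 4 +
          (q ^ (8 / 33 : ℝ) * (K : ℝ) ^ (67 / 132 : ℝ)) ^ 4) := by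
          have e₁ : (3 - 1 / 33 : ℝ) = 1 + 65 / 132 * 4 := by norm_num
          have e₂ : (3 + 1 / 33 : ℝ) = 1 + 67 / 132 * 4 := by norm_num
          have e₃ : (8 / 33 * 4 : ℝ) = 1 + -(1 / 33) := by norm_num
          have e₄ : (1 / 4 * 4 : ℝ) = 1 := by norm_num
          rw [term_pow_four hq0.le hKpos.le, term_pow_four hq0.le hKpos.le, e₁, e₂, e₃, e₄,
            Real.rpow_add hKpos, Real.rpow_add hKpos, Real.rpow_add hq0, Real.rpow_one, Real.rpow_one]
          ring
      _ ≤ K * fK ^ 4 := by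
        gcongr
        exact add_pow_four_le (by positivity) (by positivity)
  have hX4 : K * X ^ 4 ≤ K * (256 * c * fK) ^ 4 := by
    calc K * X ^ 4 ≤ 128 * (K / 64 : ℕ) * X ^ 4 := by gcongr
      _ = 128 * ((K / 64 : ℕ) * X ^ 4) := by ring
      _ ≤ 128 * (q * energy (powSet g K)) := by gcongr
      _ ≤ 128 * (q * (c * ((K : ℝ) ^ (3 - 1 / 33 : ℝ) +
          q ^ (-(1 / 33) : ℝ) * (K : ℝ) ^ (3 + 1 / 33 : ℝ)))) := by
        gcongr
        exact hE K (by omega) hKt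
      _ = 128 * c * (q * ((K : ℝ) ^ (3 - 1 / 33 : ℝ) +
          q ^ (-(1 / 33) : ℝ) * (K : ℝ) ^ (3 + 1 / 33 : ℝ))) := by ring
      _ ≤ 128 * c * (K * fK ^ 4) := by gcongr
      _ ≤ (256 * c) ^ 4 * (K * fK ^ 4) := by
        have h1 : 128 * c ≤ (256 * c) ^ 1 := by linarith
        have h2 : (256 * c) ^ 1 ≤ (256 * c) ^ 4 := pow_le_pow_right₀ (by linarith) (by norm_num)
        gcongr
        linarith
      _ = K * (256 * c * fK) ^ 4 := by ring
  have h5 := le_of_mul_le_mul_left hX4 hKpos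
  have h6 : X ≤ 256 * c * fK := le_of_pow_le_pow_left₀ (by norm_num) (by positivity) h5
  calc X ≤ 256 * c * fK := h6
    _ = _ := by ring

/-- The pointwise bound by the bilinear method. -/
theorem norm_powSum_le_of_bilinear (hχ : χ.IsPrimitive) (hc : 1 ≤ c)
    (hE : ∀ K, 1 ≤ K → K ≤ orderOf g → (energy (powSet g K) : ℝ) ≤ c *
      ((K : ℝ) ^ (3 - 1 / 33 : ℝ) +
        (Fintype.card F : ℝ) ^ (-(1 / 33) : ℝ) * (K : ℝ) ^ (3 + 1 / 33 : ℝ)))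
    {K : ℕ} (hK : K ≤ orderOf g) {a : F} (ha : a ≠ 0) :
    ‖powSum χ g K a‖ ≤ 512 * c * ((Fintype.card F : ℝ) ^ (1 / 8 : ℝ) * (K : ℝ) ^ (49 / 66 : ℝ) +
      (Fintype.card F : ℝ) ^ (31 / 264 : ℝ) * (K : ℝ) ^ (25 / 33 : ℝ)) := by
  set q : ℝ := (Fintype.card F : ℝ) with hq
  have hq1 : 1 ≤ q := by rw [hq]; exact_mod_cast Fintype.card_pos
  have hq0 : 0 < q := by linarith
  obtain ⟨h0, h1, h2, h3⟩ := two_term_scale (α := 1 / 8) (β := 31 / 264) (s := 49 / 66)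
    (u := 25 / 33) hq1 (by norm_num) (by norm_num) (by norm_num) rfl
  refine norm_powSum_le_of_shift χ g (orderOf g) h0 h1 h2 h3 (by linarith) ?_ K hK a ha
  intro K hK64 hKt a ha X hX0 hX
  have hK1 : (64 : ℝ) ≤ K := by exact_mod_cast hK64
  have hKpos : (0 : ℝ) < K := by linarith
  set H : ℕ := K / 64 with hHdef
  have hHK : H ≤ K := Nat.div_le_self _ _
  have hH : (K : ℝ) ≤ 128 * H := by
    have : K ≤ 128 * H := by omega
    exact_mod_cast this
  have hH0 : (0 : ℝ) < H := by linarith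
  set fK := q ^ (1 / 8 : ℝ) * (K : ℝ) ^ (49 / 66 : ℝ) + q ^ (31 / 264 : ℝ) * (K : ℝ) ^ (25 / 33 : ℝ)
    with hfK
  have hfK0 : 0 ≤ fK := by positivity
  set E : ℝ := (energy (powSet g K) : ℝ) with hEK
  have hsum : H * X ≤ ∑ x ∈ powSet g H, ‖charSum χ (powSet g K) (a * x)‖ := by
    rw [← sum_Icc_dilate_eq a (hHK.trans hKt) fun x ↦ ‖charSum χ (powSet g K) x‖]
    calc (H : ℝ) * X = ∑ h ∈ Icc 1 H, X := by simp
      _ ≤ _ := by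
        refine sum_le_sum fun h hh ↦ ?_
        rw [← powSum_eq_charSum χ hKt]
        exact hX h hh
  have h8 : (H * X) ^ 8 ≤ (K : ℝ) ^ 4 * (H : ℝ) ^ 4 * E * (q * E) := by
    refine (pow_le_pow_left₀ (by positivity) hsum 8).trans
      ((sum_norm_charSum_pow_eight_le hχ (powSet g K) (powSet g H) a ha).trans ?_)
    rw [card_powSet hKt, card_powSet (hHK.trans hKt)]
    have : (energy (powSet g H) : ℝ) ≤ E := by
      rw [hEK]
      exact_mod_cast energy_mono (powSet_mono g hHK)
    gcongr
  set e : ℝ := (K : ℝ) ^ (3 - 1 / 33 : ℝ) + q ^ (-(1 / 33) : ℝ) * (K : ℝ) ^ (3 + 1 / 33 : ℝ) with he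
  have he0 : 0 ≤ e := by positivity
  have hEe : E ≤ c * e := hE K (by omega) hKt
  -- As H is comparable to K, the bilinear estimate reduces to X^8 ≪ q E²; the exponents in fK are
  -- those of (q^(1/2) E)^(1/4), term by term.
  have hf4 : q ^ (1 / 2 : ℝ) * e ≤ fK ^ 4 := by
    calc q ^ (1 / 2 : ℝ) * e = (q ^ (1 / 8 : ℝ) * (K : ℝ) ^ (49 / 66 : ℝ)) ^ 4 +
          (q ^ (31 / 264 : ℝ) * (K : ℝ) ^ (25 / 33 : ℝ)) ^ 4 := by
          have e₁ : (3 - 1 / 33 : ℝ) = 49 / 66 * 4 := by norm_num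
          have e₂ : (3 + 1 / 33 : ℝ) = 25 / 33 * 4 := by norm_num
          have e₃ : (31 / 264 * 4 : ℝ) = 1 / 2 + -(1 / 33) := by norm_num
          have e₄ : (1 / 8 * 4 : ℝ) = 1 / 2 := by norm_num
          rw [term_pow_four hq0.le hKpos.le, term_pow_four hq0.le hKpos.le, he, e₁, e₂, e₃, e₄,
            Real.rpow_add hq0]
          ring
      _ ≤ fK ^ 4 := add_pow_four_le (by positivity) (by positivity)
  have hf8 : q * e ^ 2 ≤ fK ^ 8 := by
    calc q * e ^ 2 = (q ^ (1 / 2 : ℝ) * e) ^ 2 := by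
          rw [mul_pow, ← Real.rpow_natCast (q ^ (1 / 2 : ℝ)), ← Real.rpow_mul hq0.le]
          norm_num
      _ ≤ (fK ^ 4) ^ 2 := by gcongr
      _ = fK ^ 8 := by ring
  have hX8 : (H : ℝ) ^ 8 * X ^ 8 ≤ (H : ℝ) ^ 8 * (256 * c * fK) ^ 8 := by
    calc (H : ℝ) ^ 8 * X ^ 8 = (H * X) ^ 8 := by ring
      _ ≤ (K : ℝ) ^ 4 * (H : ℝ) ^ 4 * E * (q * E) := h8
      _ ≤ (128 * H) ^ 4 * (H : ℝ) ^ 4 * (c * e) * (q * (c * e)) := by gcongr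
      _ = (H : ℝ) ^ 8 * (128 ^ 4 * c ^ 2 * (q * e ^ 2)) := by ring
      _ ≤ (H : ℝ) ^ 8 * (256 ^ 8 * c ^ 8 * fK ^ 8) := by
        have : c ^ 2 ≤ c ^ 8 := pow_le_pow_right₀ hc (by norm_num)
        gcongr
        norm_num
      _ = _ := by ring
  have h5 := le_of_mul_le_mul_left hX8 (by positivity)
  have h6 : X ≤ 256 * c * fK := le_of_pow_le_pow_left₀ (by norm_num) (by positivity) h5
  calc X ≤ 256 * c * fK := h6
    _ = _ := by ring

end Bounds

theorem theorem3 (C₀ : ℝ) (hC₀ : 0 < C₀) :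
    ∃ C : ℝ, 0 < C ∧
      ∀ (p m : ℕ) [Fact p.Prime] (F : Type*) [Field F] [Fintype F] [Algebra (ZMod p) F] (q : ℕ),
        q = p ^ m → Fintype.card F = q →
        ∀ (g : Fˣ) (t : ℕ), orderOf g = t →
          (∀ ν : ℕ, 1 ≤ ν → ν < m → ν ∣ m →
            (Nat.gcd t (p ^ ν - 1) : ℝ) ≤ C₀ * (p : ℝ) ^ ((ν : ℝ) / 2)) →
          ∀ K : ℕ, K ≤ t →
            (∑ a : F, ‖incSum p g K a‖ ^ 4 ≤
              C * ((q : ℝ) * (K : ℝ) ^ (3 - 1 / 33 : ℝ)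
                + (q : ℝ) ^ (1 - 1 / 33 : ℝ) * (K : ℝ) ^ (3 + 1 / 33 : ℝ))) ∧
            (∀ a : F, a ≠ 0 → ‖incSum p g K a‖ ≤
              C * ((q : ℝ) ^ (1 / 4 : ℝ) * (K : ℝ) ^ (65 / 132 : ℝ)
                + (q : ℝ) ^ (8 / 33 : ℝ) * (K : ℝ) ^ (67 / 132 : ℝ))) ∧
            (∀ a : F, a ≠ 0 → ‖incSum p g K a‖ ≤
              C * ((q : ℝ) ^ (1 / 8 : ℝ) * (K : ℝ) ^ (49 / 66 : ℝ)
                + (q : ℝ) ^ (31 / 264 : ℝ) * (K : ℝ) ^ (25 / 33 : ℝ))) := by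
  classical
  set c : ℝ := 2 ^ 165 * (1 + 2 * C₀ ^ 2) with hc
  have hc1 : 1 ≤ c := by
    have : 0 < C₀ ^ 2 := by positivity
    rw [hc]
    linarith
  refine ⟨512 * c, by linarith, ?_⟩
  rintro p m _ F _ _ _ _ rfl hF g _ rfl hg K hK
  have hχ := traceChar_isPrimitive p F
  have hE : ∀ K, 1 ≤ K → K ≤ orderOf g → (energy (powSet g K) : ℝ) ≤ c *
      ((K : ℝ) ^ (3 - 1 / 33 : ℝ) +
        (Fintype.card F : ℝ) ^ (-(1 / 33) : ℝ) * (K : ℝ) ^ (3 + 1 / 33 : ℝ)) :=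
    fun K hK1 hK ↦ energy_powSet_le hF g hg hK1 hK
  rw [← hF]
  have hq0 : (0 : ℝ) < Fintype.card F := by exact_mod_cast Fintype.card_pos
  simp only [incSum_eq_powSum]
  refine ⟨?_, fun a ha ↦ norm_powSum_le_of_fourth_moment hχ hc1 hE hK ha,
    fun a ha ↦ norm_powSum_le_of_bilinear hχ hc1 hE hK ha⟩
  -- The energy bound starts at K = 1, so the empty sum is treated separately.
  rcases Nat.eq_zero_or_pos K with rfl | hK1
  · simp only [powSum, Icc_eq_empty_of_lt zero_lt_one, sum_empty, norm_zero]
    simp only [ne_eq, OfNat.ofNat_ne_zero, not_false_eq_true, zero_pow, sum_const_zero]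
    positivity
  have hpos : 0 ≤ (Fintype.card F : ℝ) * (K : ℝ) ^ (3 - 1 / 33 : ℝ) +
      (Fintype.card F : ℝ) ^ (1 - 1 / 33 : ℝ) * (K : ℝ) ^ (3 + 1 / 33 : ℝ) := by positivity
  calc ∑ a : F, ‖powSum (traceChar p F) g K a‖ ^ 4
      = Fintype.card F * (energy (powSet g K) : ℝ) := by
        simp only [powSum_eq_charSum _ hK, sum_norm_charSum_pow_four hχ]
    _ ≤ Fintype.card F * (c * ((K : ℝ) ^ (3 - 1 / 33 : ℝ) +
        (Fintype.card F : ℝ) ^ (-(1 / 33) : ℝ) * (K : ℝ) ^ (3 + 1 / 33 : ℝ))) := by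
        gcongr
        exact hE K hK1 hK
    _ = c * ((Fintype.card F : ℝ) * (K : ℝ) ^ (3 - 1 / 33 : ℝ) +
      (Fintype.card F : ℝ) ^ (1 - 1 / 33 : ℝ) * (K : ℝ) ^ (3 + 1 / 33 : ℝ)) := by
        rw [sub_eq_add_neg (1 : ℝ), Real.rpow_add hq0, Real.rpow_one]
        ring
    _ ≤ _ := by
        gcongr
        linarith
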